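/- All Hilbert spaces are finite-dimensional, logarithms are to base $2$, $-\log 0=+\infty$, and $\phi$ also denotes $|\phi\rangle\langle\phi|$. For positive operators let $F(\rho,\sigma)=\mathrm{Tr}\sqrt{\sqrt\rho\,\sigma\sqrt\rho}$, $F^2(\rho,\sigma)=(F(\rho,\sigma))^2$, and $S_{\min}(\rho)=-\log\lambda_{\max}(\rho)$. Let $\Psi^M_{A'B'}=\frac1{\sqrt M}\sum_{i=1}^M|i\rangle\otimes|i\rangle$ be the maximally entangled state of rank $M$ in $\mathbb C^d\otimes\mathbb C^d$, $M\le d$. LOCC maps are those implemented by local operations and finitely many rounds of classical communication. For an ensemble $\mathcal E=\{p_i,\phi^i_{AB}\}$ of finitely many normalized bipartite pure states and $\varepsilon\ge0$ put $$E_D(\mathcal E;\varepsilon)=\sup\Big\{\log M:\ M\ge1 \text{ an integer},\ F^2\Big(\sum_ip_i\Lambda^i(\phi^i_{AB}),\Psi^M_{A'B'}\Big)\ge1-\varepsilon\text{ for some } d\ge M\text{ and some LOCC maps }\Lambda^i:AB\to A'B'\Big\}.$$ For families $\bar{\mathcal E}=\{\bar\varphi^i_{AB}\}_i$ of pure states let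 $F_{\min}(\bar{\mathcal E})=\min_iS_{\min}(\mathrm{Tr}_B\bar\varphi^i_{AB})$, let $$\mathcal S_{\le}(\mathcal E;\delta)=\Big\{\{\bar\varphi^i_{AB}\}_i:\ \mathrm{Tr}\,\bar\varphi^i_{AB}\le1,\ \sum_ip_iF(\bar\varphi^i_{AB},\phi^i_{AB})\ge1-\delta\Big\},$$ and let $\mathcal S_{=}(\mathcal E;\delta)$ be the subset of the families with $\mathrm{Tr}\,\bar\varphi^i_{AB}=1$ for all $i$. **Theorem.** For every ensemble $\mathcal E$ of bipartite pure states and every $\varepsilon\ge0$, $$\max_{\bar{\mathcal E}\in\mathcal S_{=}(\mathcal E;\varepsilon/2)}F_{\min}(\bar{\mathcal E})-\Delta\ \le\ E_D(\mathcal E;\varepsilon)\ \le\ \max_{\bar{\mathcal E}\in\mathcal S_{\le}(\mathcal E;\sqrt{2\sqrt\varepsilon})}F_{\min}(\bar{\mathcal E}),$$ where both maxima are attained (the right one may be $+\infty$) and $\Delta\in[0,1]$ is the least number for which the left-hand side is the logarithm of a positive integer. If $\varepsilon<1$, the supremum $E_D(\mathcal E;\varepsilon)$ is a maximum. Moreover,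 let $\Psi_{ABC}$ be a normalized pure state, let $\rho_{AB}=\mathrm{Tr}_C\Psi_{ABC}$, and let $$E_A(\rho_{AB};\varepsilon)=\sup\Big\{\log M:\ M\ge1 \text{ an integer},\ F^2\Big(\sum_i\Lambda^i\big(\mathrm{Tr}_C[\Psi_{ABC}(1_{AB}\otimes P^i_C)]\big),\Psi^M_{A'B'}\Big)\ge1-\varepsilon\text{ for some POVM }\{P^i_C\}_i,\text{ some }d\ge M\text{ and some LOCC maps }\Lambda^i\Big\}$$ be the one-shot entanglement of assistance. Then $E_A(\rho_{AB};\varepsilon)=\max_{\mathcal E}E_D(\mathcal E;\varepsilon)$, where $\mathcal E$ ranges over the ensembles of pure states with $\sum_ip_i\phi^i_{AB}=\rho_{AB}$. -/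

import Mathlib

open scoped Kronecker MatrixOrder ComplexOrder

noncomputable section

namespace AssistedDistillation

/-- Operators on `ℂ^a ⊗ ℂ^b`, in the computational product basis. -/
abbrev Op (a b : ℕ) : Type := Matrix (Fin a × Fin b) (Fin a × Fin b) ℂ

/-- Vectors of `ℂ^a ⊗ ℂ^b`. -/
abbrev Ket (a b : ℕ) : Type := Fin a × Fin b → ℂ

/-- The rank-one operator `|v⟩⟨v|`. -/
def ketbra {ι : Type} (v : ι → ℂ) : Matrix ι ι ℂ :=
  Matrix.vecMulVec v (star v)

/-- The partial trace over the second tensor factor. -/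
def ptraceRight {ι κ : Type} [Fintype κ] (X : Matrix (ι × κ) (ι × κ) ℂ) : Matrix ι ι ℂ :=
  fun i j => ∑ k, X (i, k) (j, k)

/-- The fidelity `F(ρ, σ) = Tr √(√ρ σ √ρ)` of positive semidefinite operators. -/
def fidelity {ι : Type} [Fintype ι] [DecidableEq ι] (ρ σ : Matrix ι ι ℂ) : ℝ :=
  (CFC.sqrt (CFC.sqrt ρ * σ * CFC.sqrt ρ)).trace.re

/-- The largest eigenvalue of a Hermitian operator. -/
def lamMax {ι : Type} [Fintype ι] [DecidableEq ι] (ρ : Matrix ι ι ℂ) : ℝ :=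
  sSup (spectrum ℝ ρ)

/-- The min-entropy `-log₂ λ_max(ρ)` of a positive semidefinite operator,
with the convention `-log₂ 0 = +∞`. -/
def minEntropy {ι : Type} [Fintype ι] [DecidableEq ι] (ρ : Matrix ι ι ℂ) : EReal :=
  if lamMax ρ = 0 then ⊤ else ((-Real.logb 2 (lamMax ρ) : ℝ) : EReal)

/-- The map `X ↦ K X K†`. -/
def conjMap {ι κ : Type} [Fintype ι] (K : Matrix κ ι ℂ) :
    Matrix ι ι ℂ →ₗ[ℂ] Matrix κ κ ℂ where
  toFun X := K * X * K.conjTranspose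
  map_add' X Y := by rw [Matrix.mul_add, Matrix.add_mul]
  map_smul' c X := by simp

/-- Maps from operators on `ℂ^a ⊗ ℂ^b` to operators on `ℂ^a' ⊗ ℂ^b'` that are implemented by local
operations and classical communication in finitely many rounds: in each round one party performs a
measurement with Kraus operators `K k` on its own system (the output system of which may have
another dimension) and announces the outcome `k`, on which the rest of the protocol may depend. -/
inductive IsLOCC : {a b a' b' : ℕ} → (Op a b →ₗ[ℂ] Op a' b') → Prop
  | id {a b : ℕ} : IsLOCC (LinearMap.id : Op a b →ₗ[ℂ] Op a b)
  | alice {a a₁ b a' b' n : ℕ} (K : Fin n → Matrix (Fin a₁) (Fin a) ℂ)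
      (hK : ∑ k, (K k).conjTranspose * K k = 1)
      (Λ : Fin n → (Op a₁ b →ₗ[ℂ] Op a' b')) (hΛ : ∀ k, IsLOCC (Λ k)) :
      IsLOCC (∑ k, Λ k ∘ₗ conjMap (K k ⊗ₖ (1 : Matrix (Fin b) (Fin b) ℂ)))
  | bob {a b b₁ a' b' n : ℕ} (K : Fin n → Matrix (Fin b₁) (Fin b) ℂ)
      (hK : ∑ k, (K k).conjTranspose * K k = 1)
      (Λ : Fin n → (Op a b₁ →ₗ[ℂ] Op a' b')) (hΛ : ∀ k, IsLOCC (Λ k)) :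
      IsLOCC (∑ k, Λ k ∘ₗ conjMap ((1 : Matrix (Fin a) (Fin a) ℂ) ⊗ₖ K k))

/-- The maximally entangled state `M^{-1/2} ∑_{i < M} |i⟩ ⊗ |i⟩` of rank `M` in `ℂ^d ⊗ ℂ^d`
(used for `1 ≤ M ≤ d`). -/
def mes (d M : ℕ) : Ket d d :=
  fun x => if x.1 = x.2 ∧ x.1.val < M then ((1 / Real.sqrt M : ℝ) : ℂ) else 0

/-- A finite ensemble `{p_i, φ^i}` of normalized pure states of `ℂ^a ⊗ ℂ^b`. -/
structure PureEnsemble (a b : ℕ) where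
  /-- the number of states -/
  n : ℕ
  /-- the probabilities -/
  p : Fin n → ℝ
  p_nonneg : ∀ i, 0 ≤ p i
  p_sum : ∑ i, p i = 1
  /-- the state vectors -/
  φ : Fin n → Ket a b
  φ_normalized : ∀ i, (ketbra (φ i)).trace = 1

/-- The average state `∑_i p_i |φ^i⟩⟨φ^i|` of an ensemble. -/
def PureEnsemble.average {a b : ℕ} (E : PureEnsemble a b) : Op a b :=
  ∑ i, (E.p i : ℂ) • ketbra (E.φ i)

/-- A maximally entangled state of rank `M` can be distilled from the ensemble `E` by LOCC maps
that may depend on the label `i`, with (squared) fidelity at least `1 - ε`. -/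
def Distills {a b : ℕ} (E : PureEnsemble a b) (ε : ℝ) (M : ℕ) : Prop :=
  1 ≤ M ∧ ∃ d : ℕ, M ≤ d ∧ ∃ Λ : Fin E.n → (Op a b →ₗ[ℂ] Op d d),
    (∀ i, IsLOCC (Λ i)) ∧
      1 - ε ≤ fidelity (∑ i, (E.p i : ℂ) • Λ i (ketbra (E.φ i))) (ketbra (mes d M)) ^ 2

/-- The one-shot distillable entanglement `E_D(E; ε)` of an ensemble of pure states
(`+∞` if arbitrarily large ranks can be reached). -/
def distillableEntanglement {a b : ℕ} (E : PureEnsemble a b) (ε : ℝ) : EReal :=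
  sSup {x | ∃ M : ℕ, Distills E ε M ∧ x = ((Real.logb 2 M : ℝ) : EReal)}

/-- `F_min = min_i S_min(ρ_A^{ψ^i})` for a family of (subnormalized) pure states. -/
def Fmin {a b n : ℕ} (ψ : Fin n → Ket a b) : EReal :=
  ⨅ i, minEntropy (ptraceRight (ketbra (ψ i)))

/-- Families of subnormalized pure states with average fidelity at least `1 - δ` to `E`. -/
def closeSubnormalized {a b : ℕ} (E : PureEnsemble a b) (δ : ℝ) : Set (Fin E.n → Ket a b) :=
  {ψ | (∀ i, (ketbra (ψ i)).trace.re ≤ 1) ∧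
    1 - δ ≤ ∑ i, E.p i * fidelity (ketbra (ψ i)) (ketbra (E.φ i))}

/-- Families of normalized pure states with average fidelity at least `1 - δ` to `E`. -/
def closeNormalized {a b : ℕ} (E : PureEnsemble a b) (δ : ℝ) : Set (Fin E.n → Ket a b) :=
  {ψ | ψ ∈ closeSubnormalized E δ ∧ ∀ i, (ketbra (ψ i)).trace = 1}

/-- With the help of a party who holds `ℂ^c`, performs a POVM `P` on it and announces the outcome
`i`, a maximally entangled state of rank `M` can be distilled from the pure state `Ψ` of
`(ℂ^a ⊗ ℂ^b) ⊗ ℂ^c` with (squared) fidelity at least `1 - ε`. Here `Tr_C[Ψ (1 ⊗ P i)]` is the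
state after outcome `i` times the probability of that outcome. -/
def AssistedDistills {a b c : ℕ} (Ψ : (Fin a × Fin b) × Fin c → ℂ) (ε : ℝ) (M : ℕ) : Prop :=
  1 ≤ M ∧ ∃ (n : ℕ) (P : Fin n → Matrix (Fin c) (Fin c) ℂ),
    (∀ i, (P i).PosSemidef) ∧ ∑ i, P i = 1 ∧
    ∃ d : ℕ, M ≤ d ∧ ∃ Λ : Fin n → (Op a b →ₗ[ℂ] Op d d),
      (∀ i, IsLOCC (Λ i)) ∧
        1 - ε ≤ fidelity
          (∑ i, Λ i (ptraceRight (ketbra Ψ * ((1 : Op a b) ⊗ₖ P i)))) (ketbra (mes d M)) ^ 2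

/-- The one-shot entanglement of assistance `E_A(ρ_AB; ε)` of the state `ρ_AB = Tr_C Ψ`, expressed
through its purification `Ψ`. -/
def entanglementOfAssistance {a b c : ℕ} (Ψ : (Fin a × Fin b) × Fin c → ℂ) (ε : ℝ) : EReal :=
  sSup {x | ∃ M : ℕ, AssistedDistills Ψ ε M ∧ x = ((Real.logb 2 M : ℝ) : EReal)}

end AssistedDistillation

end

open AssistedDistillation

/-!
A ket `ψ` of `ℂ^a ⊗ ℂ^b` is identified with its coefficient matrix `mat ψ`, whose operator norm
determines the min-entropy of the reduced state: `λ_max (Tr_B ψ) = ‖mat ψ‖²`. So both bounds concern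
families of kets with `‖mat ψ i‖² ≤ 1/M`.

*Upper bound.* The fidelity of a state `σ` with the target `t = Ψ^M` satisfies `F² = ⟨t|σ|t⟩`, which
is linear in `σ`, and `‖mat t‖² ≤ 1/M`. For an LOCC map `Λ` and any `φ` there is a subnormalized `s`
with `‖mat s‖ ≤ ‖mat t‖` and `⟨t|Λ(φ)|t⟩ ≤ |⟨s|φ⟩|²` (`IsLOCC.exists_overlap_le`). This is an
induction over the rounds of the protocol: after a local measurement with Kraus operators `L k` the
kets `s k` found for the outcomes are combined to `s = ∑ c k • (L k)ᴴ s k`, with `c k` proportional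
to the amplitude `⟨s k|L k φ⟩`. The bound on `‖mat s‖` survives because the row of the `(L k)ᴴ` is a
contraction. The kets found for the members of an ensemble form the family required by the upper
bound. As `‖s‖² ≤ a ‖mat s‖² ≤ a/M`, the rank `M` is bounded if `ε < 1`, and the supremum is attained.

*Lower bound.* If `ψ` is normalized and `‖mat ψ‖² ≤ 1/M`, then the spectrum of the reduced state is a
mixture of uniform distributions on `M`-element sets, by Birkhoff's theorem, and a one-way protocol
takes `ψ` to `Ψ^M` (Nielsen's theorem). By the Cauchy–Schwarz inequality the same protocol takes any
`φ` to a state whose overlap with `Ψ^M` is at least `|⟨ψ|φ⟩|²` (`exists_isLOCC_overlap_ge`).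
Convexity of the square gives `(1 - ε/2)² ≥ 1 - ε` on average. The two maxima exist by compactness,
since `F_min` is a decreasing function of the continuous function `max_i ‖mat (ψ i)‖`.

*Assistance.* If `G` is the coefficient matrix of the purification, a measurement on the purifying
system with outcomes `P i` prepares the states `G (P i)ᵀ Gᴴ`. Factorizing the `P i` refines these to
pure states; conversely, an ensemble with average `G Gᴴ` has the form `G W` with a contraction `W`,
which defines the measurement (`assistedDistills_iff`).
-/

namespace AssistedDistillation

open Matrix

/-! ### Fidelity with a pure state -/

section Fidelity

variable {ι κ : Type}

lemma ketbra_smul (c : ℂ) (v : ι → ℂ) : ketbra (c • v) = (c * star c) • ketbra v := by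
  ext i j
  simp [ketbra, vecMulVec_apply]
  ring

variable [Fintype ι]

lemma posSemidef_ketbra (v : ι → ℂ) : (ketbra v).PosSemidef :=
  posSemidef_vecMulVec_self_star v

lemma trace_ketbra (v : ι → ℂ) : (ketbra v).trace = star v ⬝ᵥ v := by
  rw [ketbra, trace_vecMulVec, dotProduct_comm]

lemma star_dotProduct_self (v : ι → ℂ) : star v ⬝ᵥ v = ((∑ i, ‖v i‖ ^ 2 : ℝ) : ℂ) := by
  simp [dotProduct, ← Complex.normSq_eq_norm_sq, Complex.normSq_eq_conj_mul_self]

lemma trace_ketbra_re (v : ι → ℂ) : (ketbra v).trace.re = ∑ i, ‖v i‖ ^ 2 := by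
  rw [trace_ketbra, star_dotProduct_self, Complex.ofReal_re]

lemma trace_ketbra_eq (v : ι → ℂ) : (ketbra v).trace = ((ketbra v).trace.re : ℂ) := by
  rw [trace_ketbra_re, trace_ketbra, star_dotProduct_self]

lemma trace_ketbra_re_nonneg (v : ι → ℂ) : 0 ≤ (ketbra v).trace.re := by
  rw [trace_ketbra_re]; positivity

lemma trace_ketbra_re_eq_zero {v : ι → ℂ} (h : (ketbra v).trace.re = 0) : v = 0 := by
  rw [trace_ketbra_re, Finset.sum_eq_zero_iff_of_nonneg (fun _ _ => by positivity)] at h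
  funext i
  simpa using h i (Finset.mem_univ i)

lemma mul_ketbra_mul_conjTranspose (K : Matrix κ ι ℂ) (v : ι → ℂ) :
    K * ketbra v * Kᴴ = ketbra (K *ᵥ v) := by
  rw [ketbra, ketbra, mul_vecMulVec, vecMulVec_mul, star_mulVec]

lemma ketbra_mul_ketbra (v : ι → ℂ) :
    ketbra v * ketbra v = (ketbra v).trace • ketbra v := by
  rw [trace_ketbra, ketbra, vecMulVec_mul_vecMulVec]
  simp [vecMulVec_smul]

lemma star_dotProduct_ketbra_mulVec (t v : ι → ℂ) :
    (star t ⬝ᵥ (ketbra v *ᵥ t)).re = ‖star t ⬝ᵥ v‖ ^ 2 := by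
  have h : star v ⬝ᵥ t = star (star t ⬝ᵥ v) := by
    rw [star_dotProduct]
  rw [ketbra, vecMulVec_mulVec, h, dotProduct_smul, ← Complex.normSq_eq_norm_sq]
  simp [Complex.normSq_apply]

/-- The Cauchy–Schwarz inequality for kets. -/
lemma norm_star_dotProduct_sq_le (u v : ι → ℂ) :
    ‖star u ⬝ᵥ v‖ ^ 2 ≤ (ketbra u).trace.re * (ketbra v).trace.re := by
  rw [trace_ketbra_re, trace_ketbra_re]
  calc ‖star u ⬝ᵥ v‖ ^ 2 ≤ (∑ i, ‖u i‖ * ‖v i‖) ^ 2 := by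
        gcongr
        exact (norm_sum_le _ _).trans (by simp)
    _ ≤ _ := Finset.sum_mul_sq_le_sq_mul_sq _ _ _

variable [DecidableEq ι]

lemma trace_sqrt_ketbra (w : ι → ℂ) :
    (CFC.sqrt (ketbra w)).trace.re = Real.sqrt (ketbra w).trace.re := by
  set s := (ketbra w).trace.re with hs
  by_cases h0 : s = 0
  · have : w = 0 := trace_ketbra_re_eq_zero h0
    subst this
    rw [h0]
    simp [ketbra]
  have hpos : 0 < s := lt_of_le_of_ne (trace_ketbra_re_nonneg w) (Ne.symm h0)
  have hr : (Real.sqrt s) ≠ 0 := (Real.sqrt_pos.2 hpos).ne'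
  have hsq : Real.sqrt s * Real.sqrt s = s := Real.mul_self_sqrt hpos.le
  have key : CFC.sqrt (ketbra w) = (((Real.sqrt s)⁻¹ : ℝ) : ℂ) • ketbra w := by
    refine CFC.sqrt_unique ?_ ?_
    · rw [smul_mul_assoc, mul_smul_comm, ketbra_mul_ketbra, trace_ketbra_eq, ← hs, smul_smul,
        smul_smul, ← Complex.ofReal_mul, ← Complex.ofReal_mul]
      rw [show (Real.sqrt s)⁻¹ * (Real.sqrt s)⁻¹ * s = 1 by
        nth_rewrite 3 [← hsq]; field_simp]
      simp
    · refine PosSemidef.nonneg ((posSemidef_ketbra w).smul ?_)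
      exact_mod_cast (inv_nonneg.2 (Real.sqrt_nonneg s))
  rw [key, trace_smul, trace_ketbra_eq, ← hs, smul_eq_mul, ← Complex.ofReal_mul,
    Complex.ofReal_re]
  nth_rewrite 2 [← hsq]
  field_simp

/-- The fidelity with a pure state `|v⟩⟨v|` is given by `F² = ⟨v|σ|v⟩`. -/
lemma fidelity_ketbra_sq {σ : Matrix ι ι ℂ} (hσ : σ.PosSemidef) (v : ι → ℂ) :
    fidelity σ (ketbra v) ^ 2 = (star v ⬝ᵥ (σ *ᵥ v)).re := by
  have hs : (CFC.sqrt σ)ᴴ = CFC.sqrt σ :=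
    (CFC.sqrt_nonneg σ).posSemidef.1
  have h1 : CFC.sqrt σ * ketbra v * CFC.sqrt σ = ketbra (CFC.sqrt σ *ᵥ v) := by
    conv_lhs => rw [← hs]
    rw [← mul_ketbra_mul_conjTranspose, hs]
  rw [fidelity, h1, trace_sqrt_ketbra, Real.sq_sqrt (trace_ketbra_re_nonneg _), trace_ketbra,
    star_mulVec, hs, ← dotProduct_mulVec, mulVec_mulVec, CFC.sqrt_mul_sqrt_self σ hσ.nonneg]

lemma fidelity_ketbra_nonneg {σ : Matrix ι ι ℂ} (v : ι → ℂ) :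
    0 ≤ fidelity σ (ketbra v) := by
  have := (CFC.sqrt_nonneg (CFC.sqrt σ * ketbra v * CFC.sqrt σ)).posSemidef.trace_nonneg
  exact (Complex.le_def.1 this).1

lemma fidelity_ketbra_ketbra (u v : ι → ℂ) :
    fidelity (ketbra u) (ketbra v) = ‖star u ⬝ᵥ v‖ := by
  rw [← sq_eq_sq₀ (fidelity_ketbra_nonneg v) (norm_nonneg _),
    fidelity_ketbra_sq (posSemidef_ketbra u), star_dotProduct_ketbra_mulVec, ← norm_star (star u ⬝ᵥ v),
    star_dotProduct]

end Fidelity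

/-! ### Kets as matrices -/

/-- The coefficient matrix of a ket of `ℂ^a ⊗ ℂ^b`. -/
def mat {a b : ℕ} (ψ : Ket a b) : Matrix (Fin a) (Fin b) ℂ := Matrix.of fun i j => ψ (i, j)

section Mat

variable {a b a' b' : ℕ}

lemma mat_apply (ψ : Ket a b) (i : Fin a) (j : Fin b) : mat ψ i j = ψ (i, j) := rfl

lemma mat_injective : Function.Injective (mat : Ket a b → Matrix (Fin a) (Fin b) ℂ) := by
  intro u v h
  funext x
  exact congrFun (congrFun h x.1) x.2

lemma mat_smul (c : ℂ) (ψ : Ket a b) : mat (c • ψ) = c • mat ψ := rfl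

lemma mat_sum {ι : Type} (s : Finset ι) (ψ : ι → Ket a b) :
    mat (∑ k ∈ s, ψ k) = ∑ k ∈ s, mat (ψ k) := by
  ext i j
  simp [mat_apply, Finset.sum_apply, Matrix.sum_apply]

lemma mat_kronecker_mulVec (A : Matrix (Fin a') (Fin a) ℂ) (B : Matrix (Fin b') (Fin b) ℂ)
    (ψ : Ket a b) : mat ((A ⊗ₖ B) *ᵥ ψ) = A * mat ψ * Bᵀ := by
  ext i j
  simp only [mat_apply, mulVec, dotProduct, Fintype.sum_prod_type, kroneckerMap_apply, mul_apply,
    transpose_apply, Finset.sum_mul]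
  rw [Finset.sum_comm]
  exact Finset.sum_congr rfl fun _ _ => Finset.sum_congr rfl fun _ _ => by ring

lemma ptraceRight_ketbra {ι κ : Type} [Fintype κ] (ψ : ι × κ → ℂ) :
    ptraceRight (ketbra ψ) = (of fun i k => ψ (i, k)) * (of fun i k => ψ (i, k))ᴴ := by
  ext i j
  simp [ptraceRight, ketbra, vecMulVec_apply, mul_apply]

lemma ptraceRight_ketbra_ket (ψ : Ket a b) : ptraceRight (ketbra ψ) = mat ψ * (mat ψ)ᴴ :=
  ptraceRight_ketbra ψ

lemma trace_mat_mul_conjTranspose (ψ : Ket a b) :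
    (mat ψ * (mat ψ)ᴴ).trace = (ketbra ψ).trace := by
  rw [trace_ketbra, star_dotProduct_self]
  simp [Matrix.trace, mul_apply, mat_apply, Fintype.sum_prod_type, Complex.mul_conj,
    Complex.normSq_eq_norm_sq]

end Mat

/-! ### Bounds for the operator norm -/

section Norm

open scoped Matrix.Norms.L2Operator

variable {ι m n p : Type} [Fintype ι] [Fintype m] [Fintype n] [DecidableEq n] [Fintype p]
  [DecidableEq p]

lemma norm_le_one_of_conjTranspose_mul_self_eq_one {A : Matrix m n ℂ} (h : Aᴴ * A = 1) :
    ‖A‖ ≤ 1 := by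
  have h1 : ‖(1 : Matrix n n ℂ)‖ ≤ 1 := by
    rw [← diagonal_one, l2_opNorm_diagonal]
    exact (pi_norm_le_iff_of_nonneg zero_le_one).2 (by simp)
  have := l2_opNorm_conjTranspose_mul_self A
  rw [h] at this
  nlinarith [norm_nonneg A]

/-- If the `X k` are the Kraus operators of a measurement, then the row of the `(X k)ᴴ` is a
contraction, so that the combination of any operators `S k` is bounded by the column of the
`S k`. -/
lemma norm_sum_conjTranspose_mul_sq_le [DecidableEq ι] [DecidableEq m]
    (X : ι → Matrix m n ℂ) (hX : ∑ k, (X k)ᴴ * X k = 1)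
    (S : ι → Matrix m p ℂ) : ‖∑ k, (X k)ᴴ * S k‖ ^ 2 ≤ ∑ k, ‖S k‖ ^ 2 := by
  let R : Matrix (ι × m) n ℂ := of fun x j => X x.1 x.2 j
  let T : Matrix (ι × m) p ℂ := of fun x j => S x.1 x.2 j
  have hR : Rᴴ * R = 1 := by
    rw [← hX]
    ext i j
    simp [R, mul_apply, Fintype.sum_prod_type, Matrix.sum_apply]
  have hRT : ∑ k, (X k)ᴴ * S k = Rᴴ * T := by
    ext i j
    simp [R, T, mul_apply, Fintype.sum_prod_type, Matrix.sum_apply]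
  have hT : Tᴴ * T = ∑ k, (S k)ᴴ * S k := by
    ext i j
    simp [T, mul_apply, Fintype.sum_prod_type, Matrix.sum_apply]
  have h1 : ‖Rᴴ * T‖ ≤ ‖T‖ := by
    refine (l2_opNorm_mul _ _).trans ?_
    rw [l2_opNorm_conjTranspose]
    exact mul_le_of_le_one_left (norm_nonneg _) (norm_le_one_of_conjTranspose_mul_self_eq_one hR)
  rw [hRT]
  calc ‖Rᴴ * T‖ ^ 2 ≤ ‖T‖ ^ 2 := by gcongr
    _ = ‖∑ k, (S k)ᴴ * S k‖ := by rw [← hT, l2_opNorm_conjTranspose_mul_self, sq]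
    _ ≤ ∑ k, ‖S k‖ ^ 2 := by
        refine (norm_sum_le _ _).trans (Finset.sum_le_sum fun k _ => ?_)
        rw [l2_opNorm_conjTranspose_mul_self, sq]

lemma norm_replicateCol_sq (v : m → ℂ) :
    ‖replicateCol Unit v‖ ^ 2 = (ketbra v).trace.re := by
  rw [sq, ← l2_opNorm_conjTranspose_mul_self]
  have : (replicateCol Unit v)ᴴ * replicateCol Unit v
      = diagonal fun _ => (((ketbra v).trace.re : ℝ) : ℂ) := by
    rw [← trace_ketbra_eq, trace_ketbra]
    ext i j
    simp [mul_apply, dotProduct]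
  rw [this, l2_opNorm_diagonal, pi_norm_const, Complex.norm_real, Real.norm_eq_abs,
    abs_of_nonneg (trace_ketbra_re_nonneg v)]

lemma posSemidef_one_sub_of_norm_le_one {A : Matrix m n ℂ} (h : ‖A‖ ≤ 1) :
    (1 - Aᴴ * A).PosSemidef := by
  have h0 : 0 ≤ Aᴴ * A := (posSemidef_conjTranspose_mul_self A).nonneg
  have : Aᴴ * A ≤ 1 := by
    rw [← CStarAlgebra.norm_le_one_iff_of_nonneg _ h0, l2_opNorm_conjTranspose_mul_self]
    nlinarith [norm_nonneg A]
  exact this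

end Norm

/-! ### The upper bound on the overlap with the target state -/

lemma IsLOCC.posSemidef {a b a' b' : ℕ} {Λ : Op a b →ₗ[ℂ] Op a' b'} (h : IsLOCC Λ) {X : Op a b}
    (hX : X.PosSemidef) : (Λ X).PosSemidef := by
  induction h with
  | id => exact hX
  | alice K hK Λ hΛ ih =>
    rw [LinearMap.sum_apply]
    exact posSemidef_sum _ fun k _ => ih k (hX.mul_mul_conjTranspose_same _)
  | bob K hK Λ hΛ ih =>
    rw [LinearMap.sum_apply]
    exact posSemidef_sum _ fun k _ => ih k (hX.mul_mul_conjTranspose_same _)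

lemma overlap_sum_comp_conjMap {ι κ τ n : Type} [Fintype ι] [Fintype κ] [Fintype τ] [Fintype n]
    (L : n → Matrix κ ι ℂ) (Λ : n → (Matrix κ κ ℂ →ₗ[ℂ] Matrix τ τ ℂ)) (t : τ → ℂ) (φ : ι → ℂ) :
    (star t ⬝ᵥ ((∑ k, Λ k ∘ₗ conjMap (L k)) (ketbra φ) *ᵥ t)).re
      = ∑ k, (star t ⬝ᵥ (Λ k (ketbra (L k *ᵥ φ)) *ᵥ t)).re := by
  rw [LinearMap.sum_apply, sum_mulVec, dotProduct_sum, Complex.re_sum]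
  refine Finset.sum_congr rfl fun k _ => ?_
  rw [← mul_ketbra_mul_conjTranspose]
  rfl

/-- Overlaps with kets `s k` after the outcomes of a measurement with Kraus operators `L k` are
overlaps with a single ket before the measurement. The weights `c k` are proportional to the
amplitudes, which makes the Cauchy–Schwarz inequality an equality. -/
lemma exists_combination_of_kraus {ι κ n : Type} [Fintype ι] [DecidableEq ι] [Fintype κ]
    [DecidableEq κ] [Fintype n] [DecidableEq n] (L : n → Matrix κ ι ℂ)
    (hL : ∑ k, (L k)ᴴ * L k = 1) (s : n → κ → ℂ) (hs : ∀ k, (ketbra (s k)).trace.re ≤ 1)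
    (φ : ι → ℂ) :
    ∃ c : n → ℂ, ∑ k, ‖c k‖ ^ 2 ≤ 1 ∧
      (ketbra (∑ k, c k • ((L k)ᴴ *ᵥ s k))).trace.re ≤ 1 ∧
      ∑ k, ‖star (s k) ⬝ᵥ (L k *ᵥ φ)‖ ^ 2 ≤
        ‖star (∑ k, c k • ((L k)ᴴ *ᵥ s k)) ⬝ᵥ φ‖ ^ 2 := by
  set g : n → ℂ := fun k => star (s k) ⬝ᵥ (L k *ᵥ φ) with hg
  set S : ℝ := ∑ k, ‖g k‖ ^ 2 with hS
  have hS0 : 0 ≤ S := by positivity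
  set r : ℝ := (Real.sqrt S)⁻¹ with hr
  have hrS : r ^ 2 * S ≤ 1 := by
    rw [hr, inv_pow, Real.sq_sqrt hS0]
    exact inv_mul_le_one
  have hc : ∑ k, ‖(r : ℂ) * g k‖ ^ 2 ≤ 1 := by
    simpa [mul_pow, ← Finset.mul_sum, ← hS] using hrS
  refine ⟨fun k => (r : ℂ) * g k, hc, ?_, ?_⟩
  · have hcol : replicateCol Unit (∑ k, ((r : ℂ) * g k) • ((L k)ᴴ *ᵥ s k))
        = ∑ k, (L k)ᴴ * replicateCol Unit (((r : ℂ) * g k) • s k) := by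
      ext i j
      simp only [replicateCol_apply, Finset.sum_apply, Matrix.sum_apply, ← mulVec_smul]
      rfl
    rw [← norm_replicateCol_sq, hcol]
    refine (norm_sum_conjTranspose_mul_sq_le L hL _).trans (le_trans ?_ hc)
    refine Finset.sum_le_sum fun k _ => ?_
    rw [norm_replicateCol_sq, ketbra_smul, trace_smul, trace_ketbra_eq]
    have : ((r : ℂ) * g k) * star ((r : ℂ) * g k) = ((‖(r : ℂ) * g k‖ ^ 2 : ℝ) : ℂ) := by
      rw [← Complex.normSq_eq_norm_sq, ← Complex.mul_conj]; rfl
    rw [this, smul_eq_mul, ← Complex.ofReal_mul, Complex.ofReal_re]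
    exact mul_le_of_le_one_right (by positivity) (hs k)
  · have h1 : star (∑ k, ((r : ℂ) * g k) • ((L k)ᴴ *ᵥ s k)) ⬝ᵥ φ = ((r * S : ℝ) : ℂ) := by
      rw [star_sum, sum_dotProduct, hS, Finset.mul_sum, Complex.ofReal_sum]
      refine Finset.sum_congr rfl fun k _ => ?_
      rw [star_smul, star_mulVec, conjTranspose_conjTranspose, smul_dotProduct,
        ← dotProduct_mulVec]
      change star ((r : ℂ) * g k) * g k = _
      rw [← Complex.normSq_eq_norm_sq, Complex.ofReal_mul, Complex.normSq_eq_conj_mul_self]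
      simp [mul_assoc]
    rw [h1, Complex.norm_real, Real.norm_eq_abs, sq_abs]
    change S ≤ (r * S) ^ 2
    rcases hS0.eq_or_lt with h | h
    · rw [← h]; simp
    · rw [hr, mul_pow, inv_pow, Real.sq_sqrt hS0]
      field_simp
      exact le_rfl

open scoped Matrix.Norms.L2Operator

/-- The key monotonicity: if `t` is a subnormalized ket whose coefficient matrix has operator norm
at most `r`, then the overlap with `t` after an LOCC map is bounded by the overlap with a ket of the
same kind before it. -/
theorem IsLOCC.exists_overlap_le {a b a' b' : ℕ} {Λ : Op a b →ₗ[ℂ] Op a' b'} (h : IsLOCC Λ)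
    {r : ℝ} {t : Ket a' b'} (htr : ‖mat t‖ ≤ r) (ht : (ketbra t).trace.re ≤ 1) (φ : Ket a b) :
    ∃ s : Ket a b, ‖mat s‖ ≤ r ∧ (ketbra s).trace.re ≤ 1 ∧
      (star t ⬝ᵥ (Λ (ketbra φ) *ᵥ t)).re ≤ ‖star s ⬝ᵥ φ‖ ^ 2 := by
  have hr : 0 ≤ r := (norm_nonneg _).trans htr
  induction h with
  | id => exact ⟨t, htr, ht, (star_dotProduct_ketbra_mulVec t φ).le⟩
  | @alice a a₁ b a' b' n K hK Λ hΛ ih =>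
    choose s hsr hs hsφ using fun k => ih k htr ht ((K k ⊗ₖ (1 : Matrix (Fin b) (Fin b) ℂ)) *ᵥ φ)
    obtain ⟨c, hc, hc1, hcφ⟩ := exists_combination_of_kraus
      (fun k => K k ⊗ₖ (1 : Matrix (Fin b) (Fin b) ℂ))
      (by
        simp only [conjTranspose_kronecker, ← mul_kronecker_mul, conjTranspose_one, one_mul]
        rw [← one_kronecker_one, ← hK]
        ext i j
        simp [Matrix.sum_apply, Finset.sum_mul]) s hs φ
    refine ⟨_, ?_, hc1, le_trans ?_ hcφ⟩
    · rw [mat_sum]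
      have h1 : ∀ k, mat (c k • ((K k ⊗ₖ (1 : Matrix (Fin b) (Fin b) ℂ))ᴴ *ᵥ s k))
          = (K k)ᴴ * (c k • mat (s k)) := by
        intro k
        rw [mat_smul, conjTranspose_kronecker, mat_kronecker_mulVec, conjTranspose_one,
          transpose_one, Matrix.mul_one, Matrix.mul_smul]
      simp only [h1]
      refine (sq_le_sq₀ (norm_nonneg _) hr).1 ?_
      refine (norm_sum_conjTranspose_mul_sq_le K hK _).trans ?_
      calc ∑ k, ‖c k • mat (s k)‖ ^ 2 ≤ ∑ k, ‖c k‖ ^ 2 * r ^ 2 := by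
            refine Finset.sum_le_sum fun k _ => ?_
            rw [norm_smul, mul_pow]
            gcongr
            exact hsr k
        _ ≤ r ^ 2 := by
            rw [← Finset.sum_mul]
            exact mul_le_of_le_one_left (by positivity) hc
    · rw [overlap_sum_comp_conjMap]
      exact Finset.sum_le_sum fun k _ => hsφ k
  | @bob a b b₁ a' b' n K hK Λ hΛ ih =>
    choose s hsr hs hsφ using fun k => ih k htr ht (((1 : Matrix (Fin a) (Fin a) ℂ) ⊗ₖ K k) *ᵥ φ)
    obtain ⟨c, hc, hc1, hcφ⟩ := exists_combination_of_kraus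
      (fun k => (1 : Matrix (Fin a) (Fin a) ℂ) ⊗ₖ K k)
      (by
        simp only [conjTranspose_kronecker, ← mul_kronecker_mul, conjTranspose_one, one_mul]
        rw [← one_kronecker_one, ← hK]
        ext i j
        simp [Matrix.sum_apply, Finset.mul_sum]) s hs φ
    refine ⟨_, ?_, hc1, le_trans ?_ hcφ⟩
    · rw [mat_sum, ← l2_opNorm_conjTranspose, conjTranspose_sum]
      -- Bob's operators act from the right, by their entrywise conjugates after taking adjoints
      have h1 : ∀ k, (mat (c k • (((1 : Matrix (Fin a) (Fin a) ℂ) ⊗ₖ K k)ᴴ *ᵥ s k)))ᴴ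
          = ((K k)ᴴᵀ)ᴴ * (star (c k) • (mat (s k))ᴴ) := by
        intro k
        rw [mat_smul, conjTranspose_kronecker, mat_kronecker_mulVec, conjTranspose_one,
          Matrix.one_mul, conjTranspose_smul, conjTranspose_mul, Matrix.mul_smul]
      have hK' : ∑ k, ((K k)ᴴᵀ)ᴴ * (K k)ᴴᵀ = 1 := by
        rw [← transpose_one, ← hK, transpose_sum]
        refine Finset.sum_congr rfl fun k _ => ?_
        rw [transpose_mul]
        congr 1
        ext i j
        simp
      simp only [h1]
      refine (sq_le_sq₀ (norm_nonneg _) hr).1 ?_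
      refine (norm_sum_conjTranspose_mul_sq_le (fun k => (K k)ᴴᵀ) hK' _).trans ?_
      calc ∑ k, ‖star (c k) • (mat (s k))ᴴ‖ ^ 2 ≤ ∑ k, ‖c k‖ ^ 2 * r ^ 2 := by
            refine Finset.sum_le_sum fun k _ => ?_
            rw [norm_smul, mul_pow, norm_star, l2_opNorm_conjTranspose]
            gcongr
            exact hsr k
        _ ≤ r ^ 2 := by
            rw [← Finset.sum_mul]
            exact mul_le_of_le_one_left (by positivity) hc
    · rw [overlap_sum_comp_conjMap]
      exact Finset.sum_le_sum fun k _ => hsφ k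

/-! ### The maximally entangled state -/

lemma trace_ketbra_mes {d M : ℕ} (hM : 1 ≤ M) (hd : M ≤ d) : (ketbra (mes d M)).trace.re = 1 := by
  have hM0 : (0 : ℝ) < M := by exact_mod_cast hM
  rw [trace_ketbra_re, Fintype.sum_prod_type]
  have h1 : ∀ i j : Fin d, ‖mes d M (i, j)‖ ^ 2
      = if i = j then (if i.val < M then (1 / (M : ℝ)) else 0) else 0 := by
    intro i j
    by_cases hij : i = j
    · by_cases hi : i.val < M
      · simp [mes, ← hij, hi, abs_of_nonneg, Real.sq_sqrt hM0.le]
      · simp [mes, ← hij, hi]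
    · simp [mes, hij]
  simp only [h1, Finset.sum_ite_eq, Finset.mem_univ, if_true]
  rw [Fin.sum_univ_eq_sum_range (fun i => if i < M then 1 / (M : ℝ) else 0) d,
    ← Finset.sum_filter]
  have h2 : (Finset.range d).filter (fun i => i < M) = Finset.range M := by
    ext i; simp; omega
  rw [h2, Finset.sum_const, Finset.card_range]
  simp [hM0.ne']

lemma mat_mes {d M : ℕ} : mat (mes d M)
    = diagonal fun i : Fin d => if i.val < M then ((1 / Real.sqrt M : ℝ) : ℂ) else 0 := by
  ext i j
  by_cases hij : i = j
  · subst hij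
    by_cases hi : i.val < M <;> simp [mat_apply, mes, hi]
  · simp [mat_apply, mes, hij]

lemma norm_mat_mes_le (d M : ℕ) : ‖mat (mes d M)‖ ≤ 1 / Real.sqrt M := by
  rw [mat_mes, l2_opNorm_diagonal]
  refine (pi_norm_le_iff_of_nonneg (by positivity)).2 fun i => ?_
  split_ifs
  · rw [Complex.norm_real, Real.norm_eq_abs, abs_of_nonneg (by positivity)]
  · rw [norm_zero]; positivity

/-! ### Local measurements completed from given Kraus operators -/

/-- Operators with `∑ k, (K k)ᴴ * K k ≤ 1` can be completed to the Kraus operators of a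
measurement. -/
lemma exists_kraus_completion {ι m n : Type} [Fintype ι] [Fintype m] [Nonempty m] [Fintype n]
    [DecidableEq n] (K : ι → Matrix m n ℂ) (hK : (1 - ∑ k, (K k)ᴴ * K k).PosSemidef) :
    ∃ R : n → Matrix m n ℂ, ∑ k, (K k)ᴴ * K k + ∑ j, (R j)ᴴ * R j = 1 := by
  classical
  obtain ⟨S, hS⟩ := CStarAlgebra.nonneg_iff_eq_star_mul_self.1 hK.nonneg
  obtain ⟨i₀⟩ := ‹Nonempty m›
  -- the operators `|i₀⟩⟨row j of S|`
  refine ⟨fun j => vecMulVec (Pi.single i₀ 1) (S j), ?_⟩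
  rw [← eq_sub_iff_add_eq', hS]
  ext i j
  simp [Matrix.sum_apply, mul_apply, vecMulVec_apply, star_apply, Pi.single_apply]

lemma IsLOCC.alice_fintype {ι : Type} [Fintype ι] {a a₁ b a' b' : ℕ}
    (K : ι → Matrix (Fin a₁) (Fin a) ℂ) (hK : ∑ k, (K k)ᴴ * K k = 1)
    (Λ : ι → (Op a₁ b →ₗ[ℂ] Op a' b')) (hΛ : ∀ k, IsLOCC (Λ k)) :
    IsLOCC (∑ k, Λ k ∘ₗ conjMap (K k ⊗ₖ (1 : Matrix (Fin b) (Fin b) ℂ))) := by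
  let e := (Fintype.equivFin ι).symm
  rw [← e.sum_comp]
  rw [← e.sum_comp] at hK
  exact IsLOCC.alice (fun k => K (e k)) hK (fun k => Λ (e k)) fun k => hΛ _

lemma IsLOCC.bob_fintype {ι : Type} [Fintype ι] {a b b₁ a' b' : ℕ}
    (K : ι → Matrix (Fin b₁) (Fin b) ℂ) (hK : ∑ k, (K k)ᴴ * K k = 1)
    (Λ : ι → (Op a b₁ →ₗ[ℂ] Op a' b')) (hΛ : ∀ k, IsLOCC (Λ k)) :
    IsLOCC (∑ k, Λ k ∘ₗ conjMap ((1 : Matrix (Fin a) (Fin a) ℂ) ⊗ₖ K k)) := by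
  let e := (Fintype.equivFin ι).symm
  rw [← e.sum_comp]
  rw [← e.sum_comp] at hK
  exact IsLOCC.bob (fun k => K (e k)) hK (fun k => Λ (e k)) fun k => hΛ _

lemma re_dotProduct_ketbra_nonneg {a b a' b' : ℕ} {Λ : Op a b →ₗ[ℂ] Op a' b'} (h : IsLOCC Λ)
    (t : Ket a' b') (φ : Ket a b) : 0 ≤ (star t ⬝ᵥ (Λ (ketbra φ) *ᵥ t)).re :=
  (h.posSemidef (posSemidef_ketbra φ)).re_dotProduct_nonneg t

lemma exists_isLOCC_bob {a b b' : ℕ} [NeZero b'] (Y : Matrix (Fin b') (Fin b) ℂ)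
    (hY : (1 - Yᴴ * Y).PosSemidef) :
    ∃ Λ : Op a b →ₗ[ℂ] Op a b', IsLOCC Λ ∧ ∀ (t : Ket a b') (φ : Ket a b),
      ‖star t ⬝ᵥ (((1 : Matrix (Fin a) (Fin a) ℂ) ⊗ₖ Y) *ᵥ φ)‖ ^ 2
        ≤ (star t ⬝ᵥ (Λ (ketbra φ) *ᵥ t)).re := by
  obtain ⟨R, hR⟩ := exists_kraus_completion (fun _ : Unit => Y) (by simpa using hY)
  have hK : ∑ k : Unit ⊕ Fin b, (Sum.elim (fun _ => Y) R k)ᴴ * Sum.elim (fun _ => Y) R k = 1 := by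
    simpa [Fintype.sum_sum_type] using hR
  refine ⟨_, IsLOCC.bob_fintype (Sum.elim (fun _ : Unit => Y) R) hK (fun _ => LinearMap.id)
    fun _ => IsLOCC.id, fun t φ => ?_⟩
  rw [overlap_sum_comp_conjMap, Fintype.sum_sum_type]
  simp only [Sum.elim_inl, Sum.elim_inr, Finset.univ_unique, Finset.sum_singleton,
    LinearMap.id_coe, id_eq, star_dotProduct_ketbra_mulVec]
  exact le_add_of_nonneg_right (by positivity)

/-- A one-way LOCC protocol in which Alice obtains the outcome `k` by the Kraus operator `X k`, upon
which Bob applies `Y k`; all further outcomes only increase the overlap with a given ket. -/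
lemma exists_isLOCC_of_contractions {ι : Type} [Fintype ι] {a b a' b' : ℕ} [NeZero a'] [NeZero b']
    (X : ι → Matrix (Fin a') (Fin a) ℂ) (Y : ι → Matrix (Fin b') (Fin b) ℂ)
    (hX : (1 - ∑ k, (X k)ᴴ * X k).PosSemidef) (hY : ∀ k, (1 - (Y k)ᴴ * Y k).PosSemidef) :
    ∃ Λ : Op a b →ₗ[ℂ] Op a' b', IsLOCC Λ ∧ ∀ (t : Ket a' b') (φ : Ket a b),
      ∑ k, ‖star t ⬝ᵥ ((X k ⊗ₖ Y k) *ᵥ φ)‖ ^ 2 ≤ (star t ⬝ᵥ (Λ (ketbra φ) *ᵥ t)).re := by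
  obtain ⟨R, hR⟩ := exists_kraus_completion X hX
  have hK : ∑ k : ι ⊕ Fin a, (Sum.elim X R k)ᴴ * Sum.elim X R k = 1 := by
    simpa [Fintype.sum_sum_type] using hR
  have hY' : ∀ k : ι ⊕ Fin a, (1 - (Sum.elim Y (fun _ => 0) k)ᴴ *
      Sum.elim Y (fun _ => 0) k).PosSemidef := by
    rintro (k | k)
    · exact hY k
    · simpa using PosSemidef.one
  choose Λ hΛ hΛt using fun k => exists_isLOCC_bob (a := a') _ (hY' k)
  refine ⟨_, IsLOCC.alice_fintype (Sum.elim X R) hK Λ hΛ, fun t φ => ?_⟩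
  rw [overlap_sum_comp_conjMap, Fintype.sum_sum_type]
  refine le_add_of_le_of_nonneg (Finset.sum_le_sum fun k _ => ?_)
    (Finset.sum_nonneg fun k _ => re_dotProduct_ketbra_nonneg (hΛ _) _ _)
  refine le_trans (le_of_eq ?_) (hΛt (Sum.inl k) t _)
  rw [mulVec_mulVec, ← mul_kronecker_mul]
  simp

lemma exists_isLOCC {a b a' b' : ℕ} (ha : 1 ≤ a') (hb : 1 ≤ b') :
    ∃ Λ : Op a b →ₗ[ℂ] Op a' b', IsLOCC Λ := by
  have : NeZero a' := ⟨by omega⟩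
  have : NeZero b' := ⟨by omega⟩
  obtain ⟨Λ, hΛ, -⟩ := exists_isLOCC_of_contractions (fun _ : Empty => (0 : Matrix (Fin a') (Fin a) ℂ))
    (fun _ => (0 : Matrix (Fin b') (Fin b) ℂ)) (by simpa using PosSemidef.one) nofun
  exact ⟨Λ, hΛ⟩

/-! ### Whitening of positive semidefinite matrices -/

open scoped Matrix.Norms.L2Operator in
/-- With `ρ = U diag(x) Uᴴ` the operator `B = diag(x)^(-1/2) Uᴴ` (where `0^(-1/2) = 0`) whitens `ρ`,
and `Bᴴ diag(x) B` is the projection onto the range of `ρ`. -/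
lemma exists_whitening {m : Type} [Fintype m] [DecidableEq m] {ρ : Matrix m m ℂ}
    (hρ : ρ.PosSemidef) :
    ∃ (x : m → ℝ) (B : Matrix m m ℂ), (∀ j, 0 ≤ x j) ∧ (∀ j, x j ∈ spectrum ℝ ρ) ∧
      ((∑ j, x j : ℝ) : ℂ) = ρ.trace ∧
      (1 - Bᴴ * diagonal (fun j => (x j : ℂ)) * B).PosSemidef ∧
      ‖B * ρ * Bᴴ‖ ≤ 1 ∧
      Bᴴ * diagonal (fun j => (x j : ℂ)) * B = ρ * (Bᴴ * B) ∧
      Bᴴ * diagonal (fun j => (x j : ℂ)) * B * ρ = ρ := by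
  set x := hρ.1.eigenvalues with hx
  have hx0 : ∀ j, 0 ≤ x j := hρ.eigenvalues_nonneg
  set U : Matrix m m ℂ := (hρ.1.eigenvectorUnitary : Matrix m m ℂ) with hU
  have hUU : Uᴴ * U = 1 := Unitary.coe_star_mul_self hρ.1.eigenvectorUnitary
  have hUU' : U * Uᴴ = 1 := Unitary.coe_mul_star_self hρ.1.eigenvectorUnitary
  have hspec : ρ = U * diagonal (fun j => (x j : ℂ)) * Uᴴ := by
    have := hρ.1.spectral_theorem
    rw [Unitary.conjStarAlgAut_apply] at this
    exact this
  set μ : m → ℂ := fun j => (((Real.sqrt (x j))⁻¹ : ℝ) : ℂ) with hμ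
  have hμstar : star μ = μ := by
    funext j; simp [hμ]
  have hμx : ∀ j, μ j * (x j : ℂ) * μ j = if x j = 0 then 0 else 1 := by
    intro j
    by_cases h : x j = 0
    · simp [h]
    · have hs : Real.sqrt (x j) ≠ 0 :=
        (Real.sqrt_pos.2 (lt_of_le_of_ne (hx0 j) (Ne.symm h))).ne'
      have : (Real.sqrt (x j))⁻¹ * x j * (Real.sqrt (x j))⁻¹ = 1 := by
        nth_rewrite 2 [← Real.mul_self_sqrt (hx0 j)]
        field_simp
      rw [if_neg h]
      simp only [hμ]
      exact_mod_cast this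
  set B := diagonal μ * Uᴴ with hB
  have hBH : Bᴴ = U * diagonal μ := by
    rw [hB, conjTranspose_mul, conjTranspose_conjTranspose, diagonal_conjTranspose, hμstar]
  have hP : Bᴴ * diagonal (fun j => (x j : ℂ)) * B
      = U * diagonal (fun j => if x j = 0 then (0 : ℂ) else 1) * Uᴴ := by
    rw [hBH, hB]
    simp only [← hμx, ← diagonal_mul_diagonal, Matrix.mul_assoc]
  refine ⟨x, B, hx0, hρ.1.eigenvalues_mem_spectrum_real, ?_, ?_, ?_, ?_, ?_⟩
  · rw [hρ.1.trace_eq_sum_eigenvalues]; simp [hx]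
  · have : (1 : Matrix m m ℂ) - Bᴴ * diagonal (fun j => (x j : ℂ)) * B
        = U * diagonal (fun j => if x j = 0 then (1 : ℂ) else 0) * Uᴴ := by
      rw [hP]
      have hd : diagonal (fun j => if x j = 0 then (1 : ℂ) else 0)
          = 1 - diagonal (fun j => if x j = 0 then (0 : ℂ) else 1) := by
        rw [← diagonal_one, diagonal_sub]
        congr 1
        funext j
        split_ifs <;> simp
      rw [hd, Matrix.mul_sub, Matrix.sub_mul, Matrix.mul_one, hUU']
    rw [this]
    refine PosSemidef.mul_mul_conjTranspose_same (PosSemidef.diagonal fun j => ?_) U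
    dsimp only [Pi.zero_apply]
    split_ifs <;> simp
  · have : B * ρ * Bᴴ = diagonal (fun j => if x j = 0 then (0 : ℂ) else 1) := by
      rw [hBH, hB]
      nth_rewrite 1 [hspec]
      calc _ = diagonal μ * (Uᴴ * U) * diagonal (fun j => (x j : ℂ)) * (Uᴴ * U) * diagonal μ := by
            simp only [Matrix.mul_assoc]
        _ = _ := by
            rw [hUU, Matrix.mul_one, Matrix.mul_one, diagonal_mul_diagonal, diagonal_mul_diagonal]
            simp only [hμx]
    rw [this, l2_opNorm_diagonal]
    refine (pi_norm_le_iff_of_nonneg zero_le_one).2 fun j => ?_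
    split_ifs <;> simp
  · rw [hP, hBH, hB]
    conv_rhs => rw [hspec]
    calc _ = U * (diagonal (fun j => (x j : ℂ)) * diagonal μ * diagonal μ) * Uᴴ := by
          rw [diagonal_mul_diagonal, diagonal_mul_diagonal]
          congr 3
          funext j
          rw [← hμx]; ring
      _ = U * diagonal (fun j => (x j : ℂ)) * (Uᴴ * U) * (diagonal μ * (diagonal μ * Uᴴ)) := by
          rw [hUU, Matrix.mul_one]
          simp only [Matrix.mul_assoc]
      _ = _ := by simp only [Matrix.mul_assoc]
  · rw [hP]
    conv_lhs => rw [hspec]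
    conv_rhs => rw [hspec]
    calc _ = U * diagonal (fun j => if x j = 0 then (0 : ℂ) else 1) * (Uᴴ * U)
            * diagonal (fun j => (x j : ℂ)) * Uᴴ := by simp only [Matrix.mul_assoc]
      _ = U * (diagonal (fun j => if x j = 0 then (0 : ℂ) else 1)
            * diagonal (fun j => (x j : ℂ))) * Uᴴ := by
          rw [hUU, Matrix.mul_one]
          simp only [Matrix.mul_assoc]
      _ = _ := by
          rw [diagonal_mul_diagonal]
          congr 3
          funext j
          split_ifs with h <;> simp [h]

/-- If `P * A * Aᴴ = A * Aᴴ` then `P * A = A`. -/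
lemma mul_eq_self_of_mul_mul_conjTranspose {m n : Type} [Fintype m] [Fintype n] [DecidableEq m]
    {P : Matrix m m ℂ} {A : Matrix m n ℂ} (h : P * (A * Aᴴ) = A * Aᴴ) : P * A = A := by
  have h1 : (P * A - A) * (P * A - A)ᴴ = 0 := by
    have : (P * A - A) * Aᴴ = 0 := by
      rw [Matrix.sub_mul, Matrix.mul_assoc, h, sub_self]
    rw [conjTranspose_sub, conjTranspose_mul, Matrix.mul_sub, ← Matrix.mul_assoc, this,
      Matrix.zero_mul, sub_zero]
  exact sub_eq_zero.1 (self_mul_conjTranspose_eq_zero.1 h1)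

/-! ### Distillation from a single pure state -/

/-- A probability vector with entries at most `1/M` is a mixture of the uniform distributions on
`M`-element sets, by Birkhoff's theorem. The set of `σ` is enumerated by `e σ`. -/
lemma exists_mixture_of_uniform {a M : ℕ} (hM : 1 ≤ M) (x : Fin a → ℝ) (hx0 : ∀ j, 0 ≤ x j)
    (hx : ∀ j, x j ≤ 1 / M) (hsum : ∑ j, x j = 1) :
    ∃ (q : Equiv.Perm (Fin a) → ℝ) (e : Equiv.Perm (Fin a) → Fin M → Fin a),
      (∀ σ, 0 ≤ q σ) ∧ ∑ σ, q σ = 1 ∧ (∀ σ, Function.Injective (e σ)) ∧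
      ∀ j, x j = ∑ σ, ∑ k, if e σ k = j then q σ / M else 0 := by
  have hM0 : (0 : ℝ) < M := by exact_mod_cast hM
  have haM : M ≤ a := by
    have : (1 : ℝ) ≤ a * (1 / M) := by
      have h := Finset.sum_le_sum fun j (_ : j ∈ Finset.univ) => hx j
      rwa [hsum, Finset.sum_const, Finset.card_univ, Fintype.card_fin, nsmul_eq_mul] at h
    rw [mul_one_div, le_div_iff₀ hM0, one_mul] at this
    exact_mod_cast this
  obtain ⟨r, rfl⟩ := Nat.exists_eq_add_of_le haM
  have hr : ∀ j, (r : ℝ) * ((1 - M * x j) / r) = 1 - M * x j := by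
    intro j
    rcases Nat.eq_zero_or_pos r with h | h
    · -- for `r = 0` the distribution `x` is uniform
      subst h
      have h0 : ∑ j : Fin (M + 0), (1 / (M : ℝ) - x j) = 0 := by
        rw [Finset.sum_sub_distrib, hsum]
        simp [hM0.ne']
      have := (Finset.sum_eq_zero_iff_of_nonneg fun j _ => sub_nonneg.2 (hx j)).1 h0 j
        (Finset.mem_univ j)
      have hxj : x j = 1 / M := by linarith
      rw [hxj]
      field_simp
      simp
    · have : (r : ℝ) ≠ 0 := by positivity
      field_simp
  let D : Matrix (Fin (M + r)) (Fin (M + r)) ℝ :=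
    of fun j => Fin.addCases (fun _ => x j) (fun _ => (1 - M * x j) / r)
  have hD : D ∈ doublyStochastic ℝ (Fin (M + r)) := by
    rw [mem_doublyStochastic_iff_sum]
    refine ⟨fun j k => ?_, fun j => ?_, fun k => ?_⟩
    · refine Fin.addCases (fun k => ?_) (fun k => ?_) k
      · simpa [D] using hx0 j
      · have : M * x j ≤ 1 := by
          have := mul_le_mul_of_nonneg_left (hx j) hM0.le
          rwa [mul_one_div_cancel hM0.ne'] at this
        simp only [D, of_apply, Fin.addCases_right]
        exact div_nonneg (by linarith) (by positivity)
    · rw [Fin.sum_univ_add]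
      simp [D, hr]
    · refine Fin.addCases (fun k => ?_) (fun k => ?_) k
      · simpa [D] using hsum
      · have hr0 : (r : ℝ) ≠ 0 := by
          have := k.pos
          positivity
        simp only [D, of_apply, Fin.addCases_right]
        rw [← Finset.sum_div, Finset.sum_sub_distrib, ← Finset.mul_sum, hsum]
        simp [hr0]
  obtain ⟨q, hq0, hq1, hqD⟩ := exists_eq_sum_perm_of_mem_doublyStochastic hD
  refine ⟨q, fun σ k => σ.symm (Fin.castAdd r k), hq0, hq1, fun σ =>
    σ.symm.injective.comp (Fin.castAdd_injective M r), fun j => ?_⟩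
  have h1 : ∀ k : Fin M, x j = ∑ σ : Equiv.Perm (Fin (M + r)),
      if σ.symm (Fin.castAdd r k) = j then q σ else 0 := by
    intro k
    have h2 : D j (Fin.castAdd r k) = x j := by simp [D]
    rw [← h2, ← hqD]
    simp only [Equiv.Perm.permMatrix]
    simp only [Matrix.sum_apply, Matrix.smul_apply, PEquiv.toMatrix_apply, Equiv.toPEquiv_apply,
      Option.mem_def, Option.some.injEq, smul_eq_mul, mul_ite, mul_one, mul_zero]
    refine Finset.sum_congr rfl fun σ _ => ?_
    refine if_congr ?_ rfl rfl
    rw [Equiv.symm_apply_eq, eq_comm]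
  have h3 : x j = ∑ _k : Fin M, x j / M := by
    rw [Finset.sum_const, Finset.card_univ, Fintype.card_fin, nsmul_eq_mul,
      mul_div_cancel₀ _ hM0.ne']
  rw [h3, Finset.sum_comm]
  refine Finset.sum_congr rfl fun k _ => ?_
  nth_rewrite 1 [h1 k]
  rw [Finset.sum_div]
  refine Finset.sum_congr rfl fun σ _ => ?_
  split_ifs <;> simp

/-- Sandwiching a mixture of coordinate projections amounts to summing over row selections. -/
lemma sum_submatrix_mul_submatrix {S l m n : Type} [Fintype S] [Fintype l] [Fintype m]
    [DecidableEq m] {o : Type} (w : S → ℂ) (e : S → l → m) (x : m → ℂ)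
    (hx : ∀ j, x j = ∑ σ, ∑ k, if e σ k = j then w σ else 0)
    (P : Matrix m n ℂ) (Q : Matrix m o ℂ) :
    ∑ σ, w σ • ((P.submatrix (e σ) id)ᴴ * Q.submatrix (e σ) id) = Pᴴ * diagonal x * Q := by
  ext i j
  rw [mul_apply (M := Pᴴ * diagonal x)]
  simp only [mul_diagonal]
  simp only [Matrix.sum_apply, Matrix.smul_apply, mul_apply, conjTranspose_apply,
    submatrix_apply, id_eq, smul_eq_mul, hx, Finset.mul_sum, Finset.sum_mul]
  symm
  rw [Finset.sum_comm]
  refine Finset.sum_congr rfl fun σ _ => ?_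
  rw [Finset.sum_comm]
  refine Finset.sum_congr rfl fun k _ => ?_
  rw [Finset.sum_eq_single (e σ k)]
  · simp; ring
  · intro l _ hl
    simp [Ne.symm hl]
  · simp

lemma mat_conjTranspose_kronecker_mes {a b M : ℕ} (X : Matrix (Fin M) (Fin a) ℂ)
    (Y : Matrix (Fin M) (Fin b) ℂ) :
    mat ((X ⊗ₖ Y)ᴴ *ᵥ mes M M) = ((1 / Real.sqrt M : ℝ) : ℂ) • (Xᴴ * Yᴴᵀ) := by
  have h : mat (mes M M) = ((1 / Real.sqrt M : ℝ) : ℂ) • (1 : Matrix (Fin M) (Fin M) ℂ) := by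
    rw [mat_mes, smul_one_eq_diagonal]
    simp
  rw [conjTranspose_kronecker, mat_kronecker_mulVec, h, Matrix.mul_smul, Matrix.smul_mul,
    Matrix.mul_one]

open scoped Matrix.Norms.L2Operator in
/-- Nielsen's theorem for a maximally entangled target, with its consequence for nearby states: a
normalized state `ψ` whose reduced state is at most `1/M` is transformed to the maximally entangled
state of rank `M` by an LOCC map, and hence any `φ` is transformed to a state whose overlap with the
target is at least the overlap of `ψ` and `φ`. -/
theorem exists_isLOCC_overlap_ge {a b M : ℕ} (hM : 1 ≤ M) (ψ : Ket a b)
    (hψ : (ketbra ψ).trace = 1) (hψM : ‖mat ψ‖ ^ 2 ≤ 1 / M) :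
    ∃ Λ : Op a b →ₗ[ℂ] Op M M, IsLOCC Λ ∧ ∀ φ : Ket a b,
      ‖star ψ ⬝ᵥ φ‖ ^ 2 ≤ (star (mes M M) ⬝ᵥ (Λ (ketbra φ) *ᵥ mes M M)).re := by
  have : NeZero M := ⟨by omega⟩
  have hM0 : (0 : ℝ) < M := by exact_mod_cast hM
  set A := mat ψ with hA
  obtain ⟨x, B, hx0, hxs, hxt, hB1, hBn, -, hBρ⟩ :=
    exists_whitening (posSemidef_self_mul_conjTranspose A)
  have hsum : ∑ j, x j = 1 := by
    rw [trace_mat_mul_conjTranspose, hψ] at hxt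
    exact_mod_cast hxt
  have hxM : ∀ j, x j ≤ 1 / M := by
    intro j
    have : Nonempty (Fin a) := ⟨j⟩
    have h1 := spectrum.norm_le_norm_of_mem (hxs j)
    have h2 : ‖A * Aᴴ‖ = ‖A‖ ^ 2 := by
      have := l2_opNorm_conjTranspose_mul_self Aᴴ
      rw [conjTranspose_conjTranspose, l2_opNorm_conjTranspose] at this
      rw [this, sq]
    rw [h2] at h1
    exact (le_abs_self _).trans (h1.trans hψM)
  obtain ⟨q, e, hq0, hq1, he, hxe⟩ := exists_mixture_of_uniform hM x hx0 hxM hsum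
  have hBA : Bᴴ * diagonal (fun j => (x j : ℂ)) * (B * A) = A := by
    rw [← Matrix.mul_assoc]
    exact mul_eq_self_of_mul_mul_conjTranspose hBρ
  have hxe' : ∀ j, (x j : ℂ) = ∑ σ, ∑ k, if e σ k = j then ((q σ / M : ℝ) : ℂ) else 0 := by
    intro j
    rw [hxe j]
    push_cast
    refine Finset.sum_congr rfl fun σ _ => Finset.sum_congr rfl fun k _ => ?_
    split_ifs <;> simp
  -- Alice projects the whitened system on `M` coordinates, drawn according to the mixture, and Bob
  -- projects on the corresponding Schmidt vectors
  let X : Equiv.Perm (Fin a) → Matrix (Fin M) (Fin a) ℂ := fun σ =>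
    ((Real.sqrt (q σ / M) : ℝ) : ℂ) • B.submatrix (e σ) id
  let Y : Equiv.Perm (Fin a) → Matrix (Fin M) (Fin b) ℂ := fun σ =>
    ((B * A).submatrix (e σ) id)ᴴᵀ
  have hZ : ‖B * A‖ ≤ 1 := by
    have h1 := l2_opNorm_conjTranspose_mul_self (B * A)ᴴ
    rw [conjTranspose_conjTranspose, l2_opNorm_conjTranspose, conjTranspose_mul,
      Matrix.mul_assoc, ← Matrix.mul_assoc A, ← Matrix.mul_assoc B] at h1
    rw [h1] at hBn
    nlinarith [norm_nonneg (B * A)]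
  have hX1 : ∑ σ, (X σ)ᴴ * X σ = Bᴴ * diagonal (fun j => (x j : ℂ)) * B := by
    rw [← sum_submatrix_mul_submatrix _ e _ hxe']
    refine Finset.sum_congr rfl fun σ _ => ?_
    simp only [X, conjTranspose_smul, Matrix.smul_mul, Matrix.mul_smul, smul_smul]
    congr 1
    rw [← starRingEnd_apply, Complex.conj_ofReal, ← Complex.ofReal_mul,
      Real.mul_self_sqrt (div_nonneg (hq0 σ) hM0.le)]
  have hY1 : ∀ σ, (1 - (Y σ)ᴴ * Y σ).PosSemidef := by
    intro σ
    have hE : ‖((1 : Matrix (Fin a) (Fin a) ℂ).submatrix (e σ) id)‖ ≤ 1 := by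
      rw [← l2_opNorm_conjTranspose]
      refine norm_le_one_of_conjTranspose_mul_self_eq_one ?_
      ext i j
      simp [mul_apply, one_apply, (he σ).eq_iff]
    have hZσ : ‖(B * A).submatrix (e σ) id‖ ≤ 1 := by
      have : (B * A).submatrix (e σ) id
          = (1 : Matrix (Fin a) (Fin a) ℂ).submatrix (e σ) id * (B * A) := by
        ext i j
        simp [mul_apply (M := (1 : Matrix (Fin a) (Fin a) ℂ).submatrix (e σ) id), one_apply]
      rw [this]
      exact (l2_opNorm_mul _ _).trans (mul_le_one₀ hE (norm_nonneg _) hZ)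
    have h := (posSemidef_one_sub_of_norm_le_one hZσ).transpose
    rw [transpose_sub, transpose_one, transpose_mul] at h
    have hYσ : (Y σ)ᴴ = ((B * A).submatrix (e σ) id)ᵀ := by
      ext i j
      simp only [Y, conjTranspose_apply, transpose_apply, star_star]
    rw [hYσ]
    exact h
  obtain ⟨Λ, hΛ, hΛt⟩ := exists_isLOCC_of_contractions X Y (by rw [hX1]; exact hB1) hY1
  refine ⟨Λ, hΛ, fun φ => le_trans ?_ (hΛt (mes M M) φ)⟩
  have hψsum : ψ = ∑ σ, ((Real.sqrt (q σ) : ℝ) : ℂ) • ((X σ ⊗ₖ Y σ)ᴴ *ᵥ mes M M) := by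
    apply mat_injective
    rw [mat_sum, ← hA, ← hBA, ← sum_submatrix_mul_submatrix _ e _ hxe']
    refine Finset.sum_congr rfl fun σ _ => ?_
    rw [mat_smul, mat_conjTranspose_kronecker_mes]
    have : (Y σ)ᴴᵀ = (B * A).submatrix (e σ) id := by
      ext i j
      simp only [Y, conjTranspose_apply, transpose_apply, star_star]
    rw [this]
    simp only [X, conjTranspose_smul, Matrix.smul_mul, smul_smul]
    congr 1
    rw [← starRingEnd_apply, Complex.conj_ofReal, ← Complex.ofReal_mul, ← Complex.ofReal_mul]
    congr 1
    rw [Real.sqrt_div (hq0 σ)]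
    nth_rewrite 1 [← Real.mul_self_sqrt (hq0 σ), ← Real.mul_self_sqrt hM0.le]
    field_simp
  have h1 : star ψ ⬝ᵥ φ
      = ∑ σ, ((Real.sqrt (q σ) : ℝ) : ℂ) * (star (mes M M) ⬝ᵥ ((X σ ⊗ₖ Y σ) *ᵥ φ)) := by
    conv_lhs => rw [hψsum]
    rw [star_sum, sum_dotProduct]
    refine Finset.sum_congr rfl fun σ _ => ?_
    rw [star_smul, smul_dotProduct, star_mulVec, conjTranspose_conjTranspose, ← dotProduct_mulVec,
      ← starRingEnd_apply, Complex.conj_ofReal, smul_eq_mul]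
  rw [h1]
  calc _ ≤ (∑ σ, Real.sqrt (q σ) * ‖star (mes M M) ⬝ᵥ ((X σ ⊗ₖ Y σ) *ᵥ φ)‖) ^ 2 := by
        gcongr
        refine (norm_sum_le _ _).trans (le_of_eq ?_)
        refine Finset.sum_congr rfl fun σ _ => ?_
        rw [norm_mul, Complex.norm_real, Real.norm_eq_abs, abs_of_nonneg (Real.sqrt_nonneg _)]
    _ ≤ (∑ σ, Real.sqrt (q σ) ^ 2) * ∑ σ, ‖star (mes M M) ⬝ᵥ ((X σ ⊗ₖ Y σ) *ᵥ φ)‖ ^ 2 :=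
        Finset.sum_mul_sq_le_sq_mul_sq _ _ _
    _ = _ := by
        simp only [Real.sq_sqrt (hq0 _), hq1, one_mul]

/-! ### The min-entropy of the reduced states -/

section MinEntropy

open scoped Matrix.Norms.L2Operator

/-- The function `x ↦ -log₂ x` on nonnegative reals, with the value `+∞` at `0`. -/
noncomputable def negLog (x : ℝ) : EReal := if x = 0 then ⊤ else ((-Real.logb 2 x : ℝ) : EReal)

lemma negLog_anti {x y : ℝ} (hx : 0 ≤ x) (hxy : x ≤ y) : negLog y ≤ negLog x := by
  unfold negLog
  rcases hx.eq_or_lt with h | h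
  · simp [← h]
  · rw [if_neg h.ne', if_neg (h.trans_le hxy).ne', EReal.coe_le_coe_iff, neg_le_neg_iff]
    exact Real.logb_le_logb_of_le one_lt_two h hxy

lemma logb_le_neg_logb_iff {M : ℕ} (hM : 1 ≤ M) {x : ℝ} (hx : 0 < x) :
    Real.logb 2 M ≤ -Real.logb 2 x ↔ x ≤ 1 / M := by
  have hM0 : (0 : ℝ) < M := by exact_mod_cast hM
  rw [← Real.logb_inv, Real.logb_le_logb one_lt_two hM0 (inv_pos.2 hx), le_inv_comm₀ hM0 hx,
    one_div]

lemma logb_le_negLog {M : ℕ} (hM : 1 ≤ M) {x : ℝ} (hx : 0 ≤ x) (h : x ≤ 1 / M) :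
    ((Real.logb 2 M : ℝ) : EReal) ≤ negLog x := by
  unfold negLog
  split_ifs with h0
  · exact le_top
  · exact EReal.coe_le_coe_iff.2
      ((logb_le_neg_logb_iff hM (lt_of_le_of_ne hx (Ne.symm h0))).2 h)

variable {a b n : ℕ}

lemma norm_mat_mul_conjTranspose (ψ : Ket a b) : ‖mat ψ * (mat ψ)ᴴ‖ = ‖mat ψ‖ ^ 2 := by
  have := l2_opNorm_conjTranspose_mul_self (mat ψ)ᴴ
  rw [conjTranspose_conjTranspose, l2_opNorm_conjTranspose] at this
  rw [this, sq]

lemma lamMax_ptraceRight_ketbra (ha : 0 < a) (ψ : Ket a b) :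
    lamMax (ptraceRight (ketbra ψ)) = ‖mat ψ‖ ^ 2 := by
  have : Nonempty (Fin a) := ⟨⟨0, ha⟩⟩
  have hρ : 0 ≤ mat ψ * (mat ψ)ᴴ := (posSemidef_self_mul_conjTranspose _).nonneg
  rw [ptraceRight_ketbra_ket, ← norm_mat_mul_conjTranspose, lamMax]
  refine IsGreatest.csSup_eq ⟨CStarAlgebra.norm_mem_spectrum_of_nonneg hρ, fun x hx => ?_⟩
  exact (le_abs_self x).trans (spectrum.norm_le_norm_of_mem hx)

lemma minEntropy_ptraceRight_ketbra (ha : 0 < a) (ψ : Ket a b) :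
    minEntropy (ptraceRight (ketbra ψ)) = negLog (‖mat ψ‖ ^ 2) := by
  rw [minEntropy, lamMax_ptraceRight_ketbra ha, negLog]

lemma norm_mat_sq_le_trace (ha : 0 < a) (ψ : Ket a b) :
    ‖mat ψ‖ ^ 2 ≤ (ketbra ψ).trace.re := by
  have : Nonempty (Fin a) := ⟨⟨0, ha⟩⟩
  have hρ := posSemidef_self_mul_conjTranspose (mat ψ)
  have h := CStarAlgebra.norm_mem_spectrum_of_nonneg hρ.nonneg
  rw [hρ.1.spectrum_real_eq_range_eigenvalues] at h
  obtain ⟨i, hi⟩ := h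
  rw [← norm_mat_mul_conjTranspose, ← trace_mat_mul_conjTranspose,
    hρ.1.trace_eq_sum_eigenvalues, ← hi, Complex.re_sum]
  exact Finset.single_le_sum (f := fun j => hρ.1.eigenvalues j)
    (fun j _ => hρ.eigenvalues_nonneg j) (Finset.mem_univ i)

lemma trace_le_mul_norm_mat_sq (ψ : Ket a b) :
    (ketbra ψ).trace.re ≤ a * ‖mat ψ‖ ^ 2 := by
  have hρ := posSemidef_self_mul_conjTranspose (mat ψ)
  rw [← norm_mat_mul_conjTranspose, ← trace_mat_mul_conjTranspose,
    hρ.1.trace_eq_sum_eigenvalues, Complex.re_sum]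
  calc _ ≤ ∑ _j : Fin a, ‖mat ψ * (mat ψ)ᴴ‖ := by
        refine Finset.sum_le_sum fun j _ => ?_
        have : Nonempty (Fin a) := ⟨j⟩
        exact (le_abs_self _).trans
          (spectrum.norm_le_norm_of_mem (hρ.1.eigenvalues_mem_spectrum_real j))
    _ = _ := by simp

/-- `F_min` is a decreasing function of the largest operator norm of a coefficient matrix. -/
lemma Fmin_eq_negLog (ha : 0 < a) (hn : 0 < n) (ψ : Fin n → Ket a b) :
    Fmin ψ = negLog (‖fun i => mat (ψ i)‖ ^ 2) := by
  have : Nonempty (Fin n) := ⟨⟨0, hn⟩⟩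
  simp only [Fmin, minEntropy_ptraceRight_ketbra ha]
  refine le_antisymm ?_ (le_iInf fun i => ?_)
  · obtain ⟨i, hi⟩ := Finite.exists_max fun i => ‖mat (ψ i)‖
    refine (iInf_le _ i).trans (negLog_anti (by positivity) ?_)
    gcongr
    exact (pi_norm_le_iff_of_nonempty _).2 hi
  · refine negLog_anti (by positivity) ?_
    gcongr
    exact norm_le_pi_norm (fun i => mat (ψ i)) i

lemma continuous_mat : Continuous (mat : Ket a b → Matrix (Fin a) (Fin b) ℂ) :=
  continuous_pi fun _ => continuous_pi fun _ => continuous_apply _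

lemma exists_isGreatest_Fmin (ha : 0 < a) (hn : 0 < n) {K : Set (Fin n → Ket a b)}
    (hK : IsCompact K) (hne : K.Nonempty) : ∃ ψ ∈ K, IsGreatest (Fmin '' K) (Fmin ψ) := by
  have hcont : Continuous fun ψ : Fin n → Ket a b => ‖fun i => mat (ψ i)‖ :=
    continuous_norm.comp (continuous_pi fun i => continuous_mat.comp (continuous_apply i))
  obtain ⟨ψ, hψ, hmin⟩ := hK.exists_isMinOn hne hcont.continuousOn
  refine ⟨ψ, hψ, ⟨ψ, hψ, rfl⟩, ?_⟩
  rintro _ ⟨χ, hχ, rfl⟩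
  rw [Fmin_eq_negLog ha hn, Fmin_eq_negLog ha hn]
  refine negLog_anti (by positivity) ?_
  gcongr
  exact hmin hχ

lemma logb_le_Fmin (ha : 0 < a) {M : ℕ} (hM : 1 ≤ M) {ψ : Fin n → Ket a b}
    (h : ∀ i, ‖mat (ψ i)‖ ^ 2 ≤ 1 / M) : ((Real.logb 2 M : ℝ) : EReal) ≤ Fmin ψ := by
  simp only [Fmin, minEntropy_ptraceRight_ketbra ha]
  exact le_iInf fun i => logb_le_negLog hM (by positivity) (h i)

end MinEntropy

/-! ### Families of states close to an ensemble -/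

section Close

variable {a b : ℕ} (E : PureEnsemble a b)

lemma PureEnsemble.n_pos : 0 < E.n := by
  rcases Nat.eq_zero_or_pos E.n with h | h
  · have := E.p_sum
    have : IsEmpty (Fin E.n) := by rw [h]; infer_instance
    simp_all
  · exact h

lemma pos_of_trace_ketbra_eq_one {ι : Type} [Fintype ι] {v : ι → ℂ} (h : (ketbra v).trace = 1) :
    Nonempty ι := by
  by_contra hι
  rw [not_nonempty_iff] at hι
  simp [Matrix.trace] at h

lemma PureEnsemble.left_pos {a b : ℕ} (E : PureEnsemble a b) : 0 < a :=
  (pos_of_trace_ketbra_eq_one (E.φ_normalized ⟨0, E.n_pos⟩)).some.1.pos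

lemma PureEnsemble.mem_closeNormalized {δ : ℝ} (hδ : 0 ≤ δ) : E.φ ∈ closeNormalized E δ := by
  refine ⟨⟨fun i => by simp [E.φ_normalized], ?_⟩, E.φ_normalized⟩
  have : ∀ i, fidelity (ketbra (E.φ i)) (ketbra (E.φ i)) = 1 := fun i => by
    rw [fidelity_ketbra_ketbra, ← trace_ketbra, E.φ_normalized]
    simp
  simp only [this, mul_one, E.p_sum]
  linarith

lemma continuous_trace_ketbra (i : Fin E.n) :
    Continuous fun ψ : Fin E.n → Ket a b => (ketbra (ψ i)).trace := by
  simp only [trace_ketbra]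
  exact (continuous_apply i).star.dotProduct (continuous_apply i)

lemma isCompact_closeSubnormalized (δ : ℝ) : IsCompact (closeSubnormalized E δ) := by
  refine Metric.isCompact_of_isClosed_isBounded ?_ ?_
  · simp only [closeSubnormalized, fidelity_ketbra_ketbra, Set.ofPred_and, Set.ofPred_forall]
    refine IsClosed.inter (isClosed_iInter fun i => ?_) ?_
    · exact isClosed_le (Complex.continuous_re.comp (continuous_trace_ketbra E i))
        continuous_const
    · refine isClosed_le continuous_const (continuous_finsetSum _ fun i _ => ?_)
      exact continuous_const.mul
        (((continuous_apply i).star.dotProduct continuous_const).norm)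
  · refine (Metric.isBounded_closedBall (x := 0) (r := 1)).subset fun ψ hψ => ?_
    rw [mem_closedBall_zero_iff, pi_norm_le_iff_of_nonneg zero_le_one]
    intro i
    rw [pi_norm_le_iff_of_nonneg zero_le_one]
    intro x
    have h1 := hψ.1 i
    rw [trace_ketbra_re] at h1
    have h2 := (Finset.single_le_sum (f := fun x => ‖ψ i x‖ ^ 2) (fun _ _ => by positivity)
      (Finset.mem_univ x)).trans h1
    exact (sq_le_one_iff₀ (norm_nonneg _)).1 h2

lemma isCompact_closeNormalized (δ : ℝ) : IsCompact (closeNormalized E δ) := by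
  refine (isCompact_closeSubnormalized E δ).inter_right ?_
  have h : IsClosed {ψ : Fin E.n → Ket a b | ∀ i, (ketbra (ψ i)).trace = 1} := by
    rw [Set.ofPred_forall]
    exact isClosed_iInter fun i => isClosed_eq (continuous_trace_ketbra E i) continuous_const
  exact h

end Close

/-! ### Distillation and close families -/

section Distillation

open scoped Matrix.Norms.L2Operator

variable {a b : ℕ} {E : PureEnsemble a b} {ε : ℝ} {M : ℕ}

lemma fidelity_average_sq (E : PureEnsemble a b) {d : ℕ} {Λ : Fin E.n → (Op a b →ₗ[ℂ] Op d d)}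
    (hΛ : ∀ i, IsLOCC (Λ i)) (t : Ket d d) :
    fidelity (∑ i, (E.p i : ℂ) • Λ i (ketbra (E.φ i))) (ketbra t) ^ 2
      = ∑ i, E.p i * (star t ⬝ᵥ (Λ i (ketbra (E.φ i)) *ᵥ t)).re := by
  have hpos : (∑ i, (E.p i : ℂ) • Λ i (ketbra (E.φ i))).PosSemidef := by
    refine posSemidef_sum _ fun i _ => ?_
    refine ((hΛ i).posSemidef (posSemidef_ketbra _)).smul ?_
    exact_mod_cast E.p_nonneg i
  rw [fidelity_ketbra_sq hpos, sum_mulVec, dotProduct_sum, Complex.re_sum]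
  refine Finset.sum_congr rfl fun i _ => ?_
  rw [smul_mulVec, dotProduct_smul, smul_eq_mul, Complex.re_ofReal_mul]

/-- A family of normalized states whose reduced states are at most `1/M` gives a protocol. -/
lemma distills_of_mem_closeNormalized (hε : 0 ≤ ε) (hM : 1 ≤ M) {ψ : Fin E.n → Ket a b}
    (hψ : ψ ∈ closeNormalized E (ε / 2)) (h : ∀ i, ‖mat (ψ i)‖ ^ 2 ≤ 1 / M) :
    Distills E ε M := by
  choose Λ hΛ hΛφ using fun i => exists_isLOCC_overlap_ge hM (ψ i) (hψ.2 i) (h i)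
  refine ⟨hM, M, le_rfl, Λ, hΛ, ?_⟩
  rcases lt_or_ge 1 ε with hε1 | hε1
  · exact le_trans (by linarith) (sq_nonneg _)
  have hF := hψ.1.2
  simp only [fidelity_ketbra_ketbra] at hF
  rw [fidelity_average_sq E hΛ]
  calc 1 - ε ≤ (1 - ε / 2) ^ 2 := by nlinarith
    _ ≤ (∑ i, E.p i * ‖star (ψ i) ⬝ᵥ E.φ i‖) ^ 2 := by
        have : 0 ≤ 1 - ε / 2 := by linarith
        gcongr
    _ ≤ ∑ i, E.p i * ‖star (ψ i) ⬝ᵥ E.φ i‖ ^ 2 :=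
        Real.pow_arith_mean_le_arith_mean_pow _ _ _ (fun i _ => E.p_nonneg i) E.p_sum
          (fun _ _ => norm_nonneg _) 2
    _ ≤ _ := Finset.sum_le_sum fun i _ =>
        mul_le_mul_of_nonneg_left (hΛφ i (E.φ i)) (E.p_nonneg i)

lemma distills_one (E : PureEnsemble a b) (hε : 0 ≤ ε) : Distills E ε 1 := by
  refine distills_of_mem_closeNormalized hε le_rfl (E.mem_closeNormalized (by linarith)) fun i => ?_
  refine (norm_mat_sq_le_trace E.left_pos _).trans ?_
  simp [E.φ_normalized]

lemma distills_of_one_le (E : PureEnsemble a b) (hε : 1 ≤ ε) (hM : 1 ≤ M) : Distills E ε M := by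
  obtain ⟨Λ, hΛ⟩ := exists_isLOCC (a := a) (b := b) hM hM
  exact ⟨hM, M, le_rfl, fun _ => Λ, fun _ => hΛ, le_trans (by linarith) (sq_nonneg _)⟩

/-- A protocol gives a family of subnormalized states whose reduced states are at most `1/M` and
whose squared overlaps with the ensemble are at least `1 - ε` on average. -/
lemma Distills.exists_family (h : Distills E ε M) :
    ∃ ψ : Fin E.n → Ket a b, (∀ i, ‖mat (ψ i)‖ ^ 2 ≤ 1 / M) ∧
      (∀ i, (ketbra (ψ i)).trace.re ≤ 1) ∧
      1 - ε ≤ ∑ i, E.p i * ‖star (ψ i) ⬝ᵥ E.φ i‖ ^ 2 := by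
  obtain ⟨hM, d, hd, Λ, hΛ, hF⟩ := h
  choose ψ hψM hψ1 hψφ using fun i => (hΛ i).exists_overlap_le (norm_mat_mes_le d M)
    (trace_ketbra_mes hM hd).le (E.φ i)
  refine ⟨ψ, fun i => ?_, hψ1, ?_⟩
  · calc ‖mat (ψ i)‖ ^ 2 ≤ (1 / Real.sqrt M : ℝ) ^ 2 := by
          gcongr
          exact hψM i
      _ = (1 / M : ℝ) := by rw [div_pow, one_pow, Real.sq_sqrt (Nat.cast_nonneg M)]
  · rw [fidelity_average_sq E hΛ] at hF
    exact hF.trans (Finset.sum_le_sum fun i _ =>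
      mul_le_mul_of_nonneg_left (hψφ i) (E.p_nonneg i))

lemma Distills.exists_mem_closeSubnormalized (hε : 0 ≤ ε) (h : Distills E ε M) :
    ∃ ψ ∈ closeSubnormalized E (Real.sqrt (2 * Real.sqrt ε)), ∀ i, ‖mat (ψ i)‖ ^ 2 ≤ 1 / M := by
  rcases lt_or_ge 1 ε with hε1 | hε1
  · -- here the closeness condition is void, and the zero family has the value `F_min = +∞`
    refine ⟨0, ⟨fun i => ?_, ?_⟩, fun i => ?_⟩
    · simp [ketbra]
    · have h1 : 1 ≤ Real.sqrt ε := Real.one_le_sqrt.2 hε1.le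
      have h2 : 1 ≤ Real.sqrt (2 * Real.sqrt ε) := Real.one_le_sqrt.2 (by linarith)
      have h3 : 0 ≤ ∑ i, E.p i * fidelity (ketbra ((0 : Fin E.n → Ket a b) i)) (ketbra (E.φ i)) :=
        Finset.sum_nonneg fun i _ => mul_nonneg (E.p_nonneg i) (fidelity_ketbra_nonneg _)
      linarith
    · have : mat ((0 : Fin E.n → Ket a b) i) = 0 := rfl
      rw [this, norm_zero, zero_pow two_ne_zero]
      positivity
  · obtain ⟨ψ, hψM, hψ1, hψφ⟩ := h.exists_family
    refine ⟨ψ, ⟨hψ1, ?_⟩, hψM⟩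
    have h1 : ε ≤ Real.sqrt ε := Real.le_sqrt_of_sq_le (by nlinarith)
    have h2 : ε ≤ Real.sqrt (2 * Real.sqrt ε) := by
      refine Real.le_sqrt_of_sq_le ?_
      nlinarith
    refine le_trans (by linarith) (hψφ.trans (Finset.sum_le_sum fun i _ => ?_))
    rw [fidelity_ketbra_ketbra]
    refine mul_le_mul_of_nonneg_left ?_ (E.p_nonneg i)
    -- overlaps are at most one, and hence at least their squares
    have h3 := norm_star_dotProduct_sq_le (ψ i) (E.φ i)
    rw [E.φ_normalized, Complex.one_re, mul_one] at h3
    have h4 := (sq_le_one_iff₀ (norm_nonneg _)).1 (h3.trans (hψ1 i))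
    exact pow_le_of_le_one (norm_nonneg _) h4 two_ne_zero

/-- The rank that can be distilled is bounded, as the overlap of a state on `ℂ^a ⊗ ℂ^b` with the
target is at most `a/M`. -/
lemma Distills.mul_le (h : Distills E ε M) : (1 - ε) * M ≤ a := by
  have hM0 : (0 : ℝ) < M := by exact_mod_cast h.1
  obtain ⟨ψ, hψM, hψ1, hψφ⟩ := h.exists_family
  have h1 : 1 - ε ≤ a * (1 / M) := by
    refine hψφ.trans ?_
    calc _ ≤ ∑ i, E.p i * (a * (1 / M) : ℝ) := by
          refine Finset.sum_le_sum fun i _ => mul_le_mul_of_nonneg_left ?_ (E.p_nonneg i)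
          have h3 := norm_star_dotProduct_sq_le (ψ i) (E.φ i)
          rw [E.φ_normalized, Complex.one_re, mul_one] at h3
          refine h3.trans ((trace_le_mul_norm_mat_sq _).trans ?_)
          gcongr
          exact hψM i
      _ = _ := by rw [← Finset.sum_mul, E.p_sum, one_mul]
  rwa [mul_one_div, le_div_iff₀ hM0] at h1

end Distillation

/-! ### Suprema of logarithms -/

lemma exists_sSup_logb_eq {P : ℕ → Prop} (hP : ∀ M, P M → 1 ≤ M) (h1 : P 1) {B : ℝ}
    (hB : ∀ M : ℕ, P M → (M : ℝ) ≤ B) :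
    ∃ M : ℕ, P M ∧ sSup {x : EReal | ∃ M : ℕ, P M ∧ x = ((Real.logb 2 M : ℝ) : EReal)}
      = ((Real.logb 2 M : ℝ) : EReal) := by
  have hbdd : BddAbove {M | P M} := ⟨⌊B⌋₊, fun M hM => Nat.le_floor (hB M hM)⟩
  refine ⟨sSup {M | P M}, Nat.sSup_mem ⟨1, h1⟩ hbdd, le_antisymm (sSup_le ?_)
    (le_sSup ⟨_, Nat.sSup_mem ⟨1, h1⟩ hbdd, rfl⟩)⟩
  rintro _ ⟨M, hM, rfl⟩
  rw [EReal.coe_le_coe_iff]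
  refine Real.logb_le_logb_of_le one_lt_two ?_ ?_
  · exact_mod_cast hP M hM
  · exact_mod_cast le_csSup hbdd hM

/-- Rounding `-log₂ x` down to the logarithm of a positive integer, namely of `⌊1/x⌋`. -/
lemma exists_isLeast_rounding {x : ℝ} (hx0 : 0 < x) (hx1 : x ≤ 1) :
    ∃ M : ℕ, 1 ≤ M ∧ x ≤ 1 / M ∧
      IsLeast {δ : ℝ | 0 ≤ δ ∧ δ ≤ 1 ∧ ∃ M : ℕ, 1 ≤ M ∧ -Real.logb 2 x - δ = Real.logb 2 M}
        (-Real.logb 2 x - Real.logb 2 M) := by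
  have hx : 1 ≤ 1 / x := by rwa [one_le_div hx0]
  have hM : 1 ≤ ⌊1 / x⌋₊ := Nat.le_floor (by exact_mod_cast hx)
  have hM0 : (0 : ℝ) < ⌊1 / x⌋₊ := by exact_mod_cast hM
  have hle : (⌊1 / x⌋₊ : ℝ) ≤ 1 / x := Nat.floor_le (by positivity)
  have hxM : x ≤ 1 / ⌊1 / x⌋₊ := by rwa [le_one_div hx0 hM0]
  refine ⟨⌊1 / x⌋₊, hM, hxM, ⟨?_, ?_, _, hM, by ring⟩, ?_⟩
  · exact sub_nonneg.2 ((logb_le_neg_logb_iff hM hx0).2 hxM)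
  · have h1 : 1 / x ≤ 2 * ⌊1 / x⌋₊ := by
      have := (Nat.lt_floor_add_one (1 / x)).le
      have : (1 : ℝ) ≤ ⌊1 / x⌋₊ := by exact_mod_cast hM
      linarith
    have h2 := Real.logb_le_logb_of_le one_lt_two (by positivity) h1
    rw [Real.logb_mul two_ne_zero hM0.ne', Real.logb_self_eq_one one_lt_two, one_div,
      Real.logb_inv] at h2
    rw [one_div]
    linarith
  · rintro δ ⟨hδ0, -, M, hM1, hδ⟩
    have h1 : x ≤ 1 / M := (logb_le_neg_logb_iff hM1 hx0).1 (by linarith)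
    have hM1' : (0 : ℝ) < M := by exact_mod_cast hM1
    have h2 : M ≤ ⌊1 / x⌋₊ := Nat.le_floor (by rwa [le_one_div hM1' hx0])
    have h3 := Real.logb_le_logb_of_le one_lt_two hM1' (Nat.cast_le.2 h2)
    linarith

/-! ### Ensembles and measurements on the purifying system -/

section Assistance

variable {a b c : ℕ}

lemma mul_conjTranspose_eq_sum_ketbra {m n : Type} [Fintype n] (V : Matrix m n ℂ) :
    V * Vᴴ = ∑ k, ketbra fun i => V i k := by
  ext i j
  simp [mul_apply, ketbra, vecMulVec_apply, Matrix.sum_apply]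

lemma mul_ketbra_mul_conjTranspose_col {m n o : Type} [Fintype n] (G : Matrix m n ℂ)
    (W : Matrix n o ℂ) (k : o) :
    G * (ketbra fun i => W i k) * Gᴴ = ketbra fun i => (G * W) i k := by
  rw [mul_ketbra_mul_conjTranspose]
  rfl

/-- With `G` the coefficient matrix of `Ψ`, the state after the outcome `P` of a measurement on the
second system is `G Pᵀ Gᴴ`. -/
lemma ptraceRight_ketbra_mul_kronecker {ι κ : Type} [Fintype ι] [DecidableEq ι] [Fintype κ]
    (Ψ : ι × κ → ℂ) (P : Matrix κ κ ℂ) :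
    ptraceRight (ketbra Ψ * ((1 : Matrix ι ι ℂ) ⊗ₖ P))
      = (of fun i k => Ψ (i, k)) * Pᵀ * (of fun i k => Ψ (i, k))ᴴ := by
  ext i j
  simp only [ptraceRight, mul_apply, Fintype.sum_prod_type, kroneckerMap_apply, one_apply, ketbra,
    vecMulVec_apply, transpose_apply, conjTranspose_apply, of_apply, Pi.star_apply]
  rw [Finset.sum_comm]
  rw [Finset.sum_eq_single j (fun l _ hl => by simp [hl]) (by simp)]
  rw [Finset.sum_comm]
  refine Finset.sum_congr rfl fun k _ => ?_
  rw [Finset.sum_mul]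
  refine Finset.sum_congr rfl fun l _ => ?_
  simp
  ring

open scoped Matrix.Norms.L2Operator in
/-- Two factorizations `G Gᴴ = V Vᴴ` are related by a contraction: `G W = V`. -/
lemma exists_contraction_of_mul_conjTranspose_eq {m n o : Type} [Fintype m] [DecidableEq m]
    [Fintype n] [DecidableEq n] [Fintype o] [DecidableEq o] {G : Matrix m n ℂ} {V : Matrix m o ℂ}
    (h : G * Gᴴ = V * Vᴴ) : ∃ W : Matrix n o ℂ, G * W = V ∧ (1 - W * Wᴴ).PosSemidef := by
  obtain ⟨x, B, -, -, -, -, hB1, hBρ, hBV⟩ :=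
    exists_whitening (posSemidef_self_mul_conjTranspose G)
  have hnorm : ∀ {p : Type} [Fintype p] [DecidableEq p] (A : Matrix m p ℂ), A * Aᴴ = G * Gᴴ →
      ‖B * A‖ ≤ 1 := by
    intro p _ _ A hA
    have h1 := l2_opNorm_conjTranspose_mul_self (B * A)ᴴ
    rw [conjTranspose_conjTranspose, l2_opNorm_conjTranspose, conjTranspose_mul,
      Matrix.mul_assoc, ← Matrix.mul_assoc A, hA, ← Matrix.mul_assoc B] at h1
    rw [h1] at hB1
    nlinarith [norm_nonneg (B * A)]
  refine ⟨(B * G)ᴴ * (B * V), ?_, ?_⟩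
  · rw [h] at hBV
    refine Eq.trans ?_ (mul_eq_self_of_mul_mul_conjTranspose hBV)
    rw [hBρ, conjTranspose_mul]
    simp only [Matrix.mul_assoc]
  · have hW : ‖((B * G)ᴴ * (B * V))ᴴ‖ ≤ 1 := by
      rw [l2_opNorm_conjTranspose]
      refine (l2_opNorm_mul _ _).trans ?_
      rw [l2_opNorm_conjTranspose]
      exact mul_le_one₀ (hnorm G rfl) (norm_nonneg _) (hnorm V h.symm)
    have := posSemidef_one_sub_of_norm_le_one hW
    rwa [conjTranspose_conjTranspose] at this

/-- Every ensemble with average `Tr_C Ψ` arises from a measurement on the purifying system. -/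
lemma exists_povm_of_ensemble {Ψ : (Fin a × Fin b) × Fin c → ℂ} (E : PureEnsemble a b)
    (hE : E.average = ptraceRight (ketbra Ψ)) :
    ∃ P : Fin E.n → Matrix (Fin c) (Fin c) ℂ, (∀ i, (P i).PosSemidef) ∧ ∑ i, P i = 1 ∧
      ∀ i, ptraceRight (ketbra Ψ * ((1 : Op a b) ⊗ₖ P i)) = (E.p i : ℂ) • ketbra (E.φ i) := by
  let G : Matrix (Fin a × Fin b) (Fin c) ℂ := of fun i k => Ψ (i, k)
  let V : Matrix (Fin a × Fin b) (Fin E.n) ℂ := of fun x i => (Real.sqrt (E.p i) : ℂ) * E.φ i x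
  have hVi : ∀ i, (ketbra fun x => V x i) = (E.p i : ℂ) • ketbra (E.φ i) := by
    intro i
    have : (fun x => V x i) = ((Real.sqrt (E.p i) : ℝ) : ℂ) • E.φ i := rfl
    rw [this, ketbra_smul, ← starRingEnd_apply, Complex.conj_ofReal, ← Complex.ofReal_mul,
      Real.mul_self_sqrt (E.p_nonneg i)]
  have hGV : G * Gᴴ = V * Vᴴ := by
    rw [mul_conjTranspose_eq_sum_ketbra V, ← ptraceRight_ketbra, ← hE]
    exact Finset.sum_congr rfl fun i _ => (hVi i).symm
  obtain ⟨W, hW, hW1⟩ := exists_contraction_of_mul_conjTranspose_eq hGV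
  -- the part of the identity that is not seen by `Ψ` is added to the first outcome
  let i₀ : Fin E.n := ⟨0, E.n_pos⟩
  let Q : Matrix (Fin c) (Fin c) ℂ := 1 - W * Wᴴ
  have hQ : G * Q * Gᴴ = 0 := by
    have : G * (W * Wᴴ) * Gᴴ = V * Vᴴ := by
      rw [← hW, conjTranspose_mul]
      simp only [Matrix.mul_assoc]
    simp only [Q]
    rw [Matrix.mul_sub, Matrix.sub_mul, this, Matrix.mul_one, hGV, sub_self]
  refine ⟨fun i => ((ketbra fun k => W k i) + if i = i₀ then Q else 0)ᵀ, fun i => ?_, ?_,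
    fun i => ?_⟩
  · refine ((posSemidef_ketbra _).add ?_).transpose
    split_ifs
    · exact hW1
    · exact PosSemidef.zero
  · rw [← transpose_sum, Finset.sum_add_distrib, ← mul_conjTranspose_eq_sum_ketbra]
    simp [Q]
  · rw [ptraceRight_ketbra_mul_kronecker, transpose_transpose, ← hVi]
    change G * _ * Gᴴ = _
    rw [Matrix.mul_add, Matrix.add_mul, mul_ketbra_mul_conjTranspose_col, hW]
    split_ifs
    · rw [hQ, add_zero]
    · rw [Matrix.mul_zero, Matrix.zero_mul, add_zero]

lemma exists_normalized {ι : Type} [Fintype ι] [DecidableEq ι] [Nonempty ι] (v : ι → ℂ) :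
    ∃ φ : ι → ℂ, (ketbra φ).trace = 1 ∧
      (((ketbra v).trace.re : ℝ) : ℂ) • ketbra φ = ketbra v := by
  by_cases h : (ketbra v).trace.re = 0
  · obtain ⟨i⟩ := ‹Nonempty ι›
    refine ⟨Pi.single i 1, ?_, ?_⟩
    · rw [trace_ketbra]
      simp
    · rw [trace_ketbra_re_eq_zero h]
      simp [ketbra]
  · set s := (ketbra v).trace.re with hs
    have hs0 : 0 ≤ s := trace_ketbra_re_nonneg v
    have key : s * ((Real.sqrt s)⁻¹ * (Real.sqrt s)⁻¹) = 1 := by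
      rw [← mul_inv, Real.mul_self_sqrt hs0, mul_inv_cancel₀ h]
    have hφ : ketbra ((((Real.sqrt s)⁻¹ : ℝ) : ℂ) • v)
        = (((Real.sqrt s)⁻¹ * (Real.sqrt s)⁻¹ : ℝ) : ℂ) • ketbra v := by
      rw [ketbra_smul, ← starRingEnd_apply, Complex.conj_ofReal, ← Complex.ofReal_mul]
    refine ⟨(((Real.sqrt s)⁻¹ : ℝ) : ℂ) • v, ?_, ?_⟩
    · rw [hφ, trace_smul, trace_ketbra_eq, ← hs, smul_eq_mul, ← Complex.ofReal_mul, mul_comm, key,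
        Complex.ofReal_one]
    · rw [hφ, smul_smul, ← Complex.ofReal_mul, key, Complex.ofReal_one, one_smul]

/-- Every measurement on the purifying system can be refined such that it prepares an ensemble of
pure states; `f` maps an outcome of the refinement to the outcome that it refines. -/
lemma exists_ensemble_of_povm {Ψ : (Fin a × Fin b) × Fin c → ℂ} (hΨ : (ketbra Ψ).trace = 1)
    {n : ℕ} (P : Fin n → Matrix (Fin c) (Fin c) ℂ) (hP : ∀ i, (P i).PosSemidef)
    (hP1 : ∑ i, P i = 1) :
    ∃ (E : PureEnsemble a b) (f : Fin E.n → Fin n), E.average = ptraceRight (ketbra Ψ) ∧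
      ∀ (d : ℕ) (Λ : Fin n → (Op a b →ₗ[ℂ] Op d d)),
        ∑ i, Λ i (ptraceRight (ketbra Ψ * ((1 : Op a b) ⊗ₖ P i)))
          = ∑ j, (E.p j : ℂ) • Λ (f j) (ketbra (E.φ j)) := by
  let G : Matrix (Fin a × Fin b) (Fin c) ℂ := of fun i k => Ψ (i, k)
  have : Nonempty (Fin a × Fin b) := (pos_of_trace_ketbra_eq_one hΨ).map Prod.fst
  choose S hS using fun i => CStarAlgebra.nonneg_iff_eq_star_mul_self.1 (hP i).transpose.nonneg
  let v : Fin n × Fin c → Ket a b := fun x y => (G * (S x.1)ᴴ) y x.2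
  have hv : ∀ i, ptraceRight (ketbra Ψ * ((1 : Op a b) ⊗ₖ P i)) = ∑ k, ketbra (v (i, k)) := by
    intro i
    rw [ptraceRight_ketbra_mul_kronecker, hS,
      ← mul_conjTranspose_eq_sum_ketbra (G * (S i)ᴴ), conjTranspose_mul,
      conjTranspose_conjTranspose]
    simp only [G, star_eq_conjTranspose, Matrix.mul_assoc]
  choose φ hφ1 hφ using fun x => exists_normalized (v x)
  have hsum : ∑ x, ketbra (v x) = ptraceRight (ketbra Ψ) := by
    rw [Fintype.sum_prod_type, ptraceRight_ketbra]
    simp only [← hv, ptraceRight_ketbra_mul_kronecker]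
    rw [← Matrix.sum_mul, ← Matrix.mul_sum, ← transpose_sum, hP1, transpose_one, Matrix.mul_one]
  have htr : (ptraceRight (ketbra Ψ)).trace = 1 := by
    rw [← hΨ]
    simp [ptraceRight, Matrix.trace, Fintype.sum_prod_type]
  let e : Fin (n * c) ≃ Fin n × Fin c := finProdFinEquiv.symm
  let E : PureEnsemble a b :=
    { n := n * c
      p := fun j => (ketbra (v (e j))).trace.re
      p_nonneg := fun j => trace_ketbra_re_nonneg _
      p_sum := by
        rw [e.sum_comp fun x => (ketbra (v x)).trace.re, ← Complex.re_sum, ← trace_sum, hsum, htr,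
          Complex.one_re]
      φ := fun j => φ (e j)
      φ_normalized := fun j => hφ1 _ }
  refine ⟨E, fun j => (e j).1, ?_, fun d Λ => ?_⟩
  · rw [← hsum, ← e.sum_comp]
    exact Finset.sum_congr rfl fun j _ => hφ _
  · simp only [hv, map_sum]
    rw [← Fintype.sum_prod_type', ← e.sum_comp]
    refine Finset.sum_congr rfl fun j _ => ?_
    rw [← map_smul]
    exact congrArg _ (hφ _).symm

/-- Assistance by the purifying system amounts to the choice of an ensemble. -/
theorem assistedDistills_iff {Ψ : (Fin a × Fin b) × Fin c → ℂ} (hΨ : (ketbra Ψ).trace = 1) {ε : ℝ}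
    {M : ℕ} : AssistedDistills Ψ ε M ↔
      ∃ E : PureEnsemble a b, E.average = ptraceRight (ketbra Ψ) ∧ Distills E ε M := by
  constructor
  · rintro ⟨hM, n, P, hP, hP1, d, hd, Λ, hΛ, hF⟩
    obtain ⟨E, f, hE, hEΛ⟩ := exists_ensemble_of_povm hΨ P hP hP1
    exact ⟨E, hE, hM, d, hd, fun j => Λ (f j), fun j => hΛ _, hEΛ d Λ ▸ hF⟩
  · rintro ⟨E, hE, hM, d, hd, Λ, hΛ, hF⟩
    obtain ⟨P, hP, hP1, hPE⟩ := exists_povm_of_ensemble E hE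
    refine ⟨hM, E.n, P, hP, hP1, d, hd, Λ, hΛ, ?_⟩
    simpa only [hPE, map_smul] using hF

lemma exists_ensemble_average_eq {Ψ : (Fin a × Fin b) × Fin c → ℂ} (hΨ : (ketbra Ψ).trace = 1) :
    ∃ E : PureEnsemble a b, E.average = ptraceRight (ketbra Ψ) := by
  obtain ⟨E, -, hE, -⟩ := exists_ensemble_of_povm hΨ (fun _ : Fin 1 => 1)
    (fun _ => PosSemidef.one) (by simp)
  exact ⟨E, hE⟩

end Assistance

/-! ### The one-shot quantities -/

/-- For `ε < 1` the supremum `E_D(E; ε)` is attained. -/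
lemma exists_distillableEntanglement_eq {a b : ℕ} (E : PureEnsemble a b) {ε : ℝ} (hε : 0 ≤ ε)
    (hε1 : ε < 1) : ∃ M : ℕ, Distills E ε M ∧
      distillableEntanglement E ε = ((Real.logb 2 M : ℝ) : EReal) :=
  exists_sSup_logb_eq (fun _ h => h.1) (distills_one E hε) (B := a / (1 - ε)) fun M h => by
    rw [le_div_iff₀ (sub_pos.2 hε1), mul_comm]
    exact h.mul_le

open scoped Matrix.Norms.L2Operator in
/-- The smoothed min-entropy bounds on `E_D(E; ε)`. -/
lemma exists_bounds_distillableEntanglement {a b : ℕ} (E : PureEnsemble a b) {ε : ℝ}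
    (hε : 0 ≤ ε) :
    ∃ (L Δ : ℝ) (U : EReal),
      IsGreatest (Fmin '' closeNormalized E (ε / 2)) (L : EReal) ∧
      IsGreatest (Fmin '' closeSubnormalized E (Real.sqrt (2 * Real.sqrt ε))) U ∧
      IsLeast {δ : ℝ | 0 ≤ δ ∧ δ ≤ 1 ∧ ∃ M : ℕ, 1 ≤ M ∧ L - δ = Real.logb 2 M} Δ ∧
      ((L - Δ : ℝ) : EReal) ≤ distillableEntanglement E ε ∧
      distillableEntanglement E ε ≤ U := by
  obtain ⟨ψ, hψ, hψL⟩ := exists_isGreatest_Fmin E.left_pos E.n_pos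
    (isCompact_closeNormalized E (ε / 2)) ⟨_, E.mem_closeNormalized (by linarith)⟩
  obtain ⟨χ, -, hχU⟩ := exists_isGreatest_Fmin E.left_pos E.n_pos
    (isCompact_closeSubnormalized E (Real.sqrt (2 * Real.sqrt ε)))
    ⟨_, (E.mem_closeNormalized (Real.sqrt_nonneg _)).1⟩
  have hi : Nonempty (Fin E.n) := ⟨⟨0, E.n_pos⟩⟩
  let x : ℝ := ‖fun i => mat (ψ i)‖ ^ 2
  have hψx : ∀ i, ‖mat (ψ i)‖ ^ 2 ≤ x := fun i =>
    pow_le_pow_left₀ (norm_nonneg _) (norm_le_pi_norm (fun i => mat (ψ i)) i) 2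
  have hx0 : 0 < x := by
    obtain ⟨i⟩ := hi
    have h := trace_le_mul_norm_mat_sq (ψ i)
    rw [hψ.2 i, Complex.one_re] at h
    refine lt_of_lt_of_le ?_ (hψx i)
    exact lt_of_mul_lt_mul_left (a := (a : ℝ)) (by linarith) (Nat.cast_nonneg a)
  have hx1 : x ≤ 1 := by
    refine pow_le_one₀ (norm_nonneg _) ((pi_norm_le_iff_of_nonempty _).2 fun i => ?_)
    have h := norm_mat_sq_le_trace E.left_pos (ψ i)
    rw [hψ.2 i, Complex.one_re] at h
    exact (sq_le_one_iff₀ (norm_nonneg _)).1 h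
  rw [Fmin_eq_negLog E.left_pos E.n_pos, negLog, if_neg hx0.ne'] at hψL
  obtain ⟨M, hM, hxM, hleast⟩ := exists_isLeast_rounding hx0 hx1
  refine ⟨_, _, _, hψL, hχU, hleast, ?_, sSup_le ?_⟩
  · rw [sub_sub_cancel]
    exact le_sSup ⟨M, distills_of_mem_closeNormalized hε hM hψ fun i => (hψx i).trans hxM, rfl⟩
  · rintro _ ⟨M, h, rfl⟩
    obtain ⟨ω, hω, hωM⟩ := h.exists_mem_closeSubnormalized hε
    exact (logb_le_Fmin E.left_pos h.1 hωM).trans (hχU.2 ⟨ω, hω, rfl⟩)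

/-- The one-shot entanglement of assistance is the largest distillable entanglement of an ensemble
with the given average. -/
lemma isGreatest_entanglementOfAssistance {a b c : ℕ} {Ψ : (Fin a × Fin b) × Fin c → ℂ}
    (hΨ : (ketbra Ψ).trace = 1) {ε : ℝ} (hε : 0 ≤ ε) :
    IsGreatest {x : EReal | ∃ E : PureEnsemble a b,
        E.average = ptraceRight (ketbra Ψ) ∧ x = distillableEntanglement E ε}
      (entanglementOfAssistance Ψ ε) := by
  have hle : ∀ E : PureEnsemble a b, E.average = ptraceRight (ketbra Ψ) →
      distillableEntanglement E ε ≤ entanglementOfAssistance Ψ ε := by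
    intro E hE
    refine sSup_le_sSup ?_
    rintro _ ⟨M, hM, rfl⟩
    exact ⟨M, (assistedDistills_iff hΨ).2 ⟨E, hE, hM⟩, rfl⟩
  obtain ⟨E₀, hE₀⟩ := exists_ensemble_average_eq hΨ
  refine ⟨?_, fun x ⟨E, hE, hx⟩ => hx ▸ hle E hE⟩
  rcases lt_or_ge ε 1 with hε1 | hε1
  · -- the optimal rank in the assisted setting is distilled from some ensemble
    obtain ⟨M, hM, hM'⟩ := exists_sSup_logb_eq (P := AssistedDistills Ψ ε) (fun _ h => h.1)
      ((assistedDistills_iff hΨ).2 ⟨E₀, hE₀, distills_one E₀ hε⟩) (B := a / (1 - ε)) fun M h => by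
        obtain ⟨E, -, hE⟩ := (assistedDistills_iff hΨ).1 h
        rw [le_div_iff₀ (sub_pos.2 hε1), mul_comm]
        exact hE.mul_le
    obtain ⟨E, hE, hEM⟩ := (assistedDistills_iff hΨ).1 hM
    refine ⟨E, hE, le_antisymm ?_ (hle E hE)⟩
    exact hM'.trans_le (le_sSup ⟨M, hEM, rfl⟩)
  · -- every rank can be reached
    refine ⟨E₀, hE₀, le_antisymm (sSup_le_sSup ?_) (hle E₀ hE₀)⟩
    rintro _ ⟨M, hM, rfl⟩
    exact ⟨M, distills_of_one_le E₀ hε1 hM.1, rfl⟩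

end AssistedDistillation

theorem theorem2 (a b : ℕ) (ε : ℝ) (hε : 0 ≤ ε) :
    (∀ E : PureEnsemble a b,
      (ε < 1 → ∃ M : ℕ, Distills E ε M ∧
        distillableEntanglement E ε = ((Real.logb 2 M : ℝ) : EReal)) ∧
      ∃ (L Δ : ℝ) (U : EReal),
        IsGreatest (Fmin '' closeNormalized E (ε / 2)) (L : EReal) ∧
        IsGreatest (Fmin '' closeSubnormalized E (Real.sqrt (2 * Real.sqrt ε))) U ∧
        IsLeast {δ : ℝ | 0 ≤ δ ∧ δ ≤ 1 ∧ ∃ M : ℕ, 1 ≤ M ∧ L - δ = Real.logb 2 M} Δ ∧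
        ((L - Δ : ℝ) : EReal) ≤ distillableEntanglement E ε ∧
        distillableEntanglement E ε ≤ U) ∧
    (∀ (c : ℕ) (Ψ : (Fin a × Fin b) × Fin c → ℂ), (ketbra Ψ).trace = 1 →
      IsGreatest
        {x : EReal | ∃ E : PureEnsemble a b,
          E.average = ptraceRight (ketbra Ψ) ∧ x = distillableEntanglement E ε}
        (entanglementOfAssistance Ψ ε)) :=
  ⟨fun E => ⟨exists_distillableEntanglement_eq E hε, exists_bounds_distillableEntanglement E hε⟩,
    fun _ _ hΨ => isGreatest_entanglementOfAssistance hΨ hε⟩
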